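/- Let $(\zeta_j)_{j\in\mathbb Z}$ be i.i.d. positive random variables with finite mean $\mu$. Define the environment $\omega=(\omega_k)_{k\in\mathbb Z}$ by $\omega_0=0$ and $\omega_k=\omega_{k-1}+\zeta_k$ for all $k\in\mathbb Z$, and let $P$ be its law on the set $\Omega$ of strictly increasing sequences $\omega:\mathbb Z\to\mathbb R$ with $\omega_0=0$ (with the $\sigma$-algebra generated by the coordinates). Let $(p_k)_{k\in\mathbb Z}$ be a probability density on $\mathbb Z$ with $p_{-k}=p_k$ for all $k$, $p_{k+1}\le p_k$ for all $k\ge 0$, and $\sum_k k^2p_k\in(0,\infty)$. Let $\xi_1,\xi_2,\dots$ be i.i.d. with density $(p_k)$, let $S_0=0$, $S_n=\xi_1+\dots+\xi_n$, and let $Q$ be the law of $S=(S_n)_{n\ge 0}$ on $\mathbb Z^{\mathbb N}$. Put $$\bar m=\sum_{k\in\mathbb Z}|k|\,p_k,\qquad m_2=\lim_{n\to\infty}\frac{E_Q(|S_n|^2)}{n}.$$ For given $S$ and $\omega$ let $\tau(0)=0$, $\tau(n)=\sum_{k=1}^n|\omega_{S_k}-\omega_{S_{k-1}}|$, and define $$X(t)=\omega_{S_n}+\operatorname{sgn}(\xi_{n+1})\,(t-\tau(n))\quad\text{for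 } t\in[\tau(n),\tau(n+1)).$$ For every $\omega\in\Omega$ this defines, for $Q$-a.e. $S$, a continuous path on $[0,\infty)$. Let $P_\omega$ be the law of $X$ under $Q$, for fixed $\omega$, on the space $\mathcal C=C([0,\infty);\mathbb R)$ with the Borel $\sigma$-algebra of the Skorokhod topology (which on $\mathcal C$ is that of locally uniform convergence), and let $\mathbb P$ be the annealed law, i.e. the probability measure on $\mathcal C\times\Omega$ with $$\mathbb P(G\times F)=\int_F P_\omega(G)\,P(d\omega)$$ for all measurable $G\subseteq\mathcal C$ and $F\subseteq\Omega$. Then the limit defining $m_2$ exists, and under $\mathbb P$ $$\frac{X(t)}{\sqrt t}\ \longrightarrow\ \mathcal N\!\left(0,\frac{\mu}{\bar m}\,m_2\right)\quad\text{in distribution as } t\to\infty,$$ where $\mathcal N(0,\sigma^2)$ is the centered normal distribution with variance $\sigma^2$. -/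

import Mathlib

open MeasureTheory ProbabilityTheory Filter Topology
open scoped NNReal

noncomputable section

namespace LevyWalk

/-! The environment -/

/-- An environment: a strictly increasing bi-infinite array `ω` of targets with `ω 0 = 0`. -/
def Env : Type := {ω : ℤ → ℝ // ω 0 = 0 ∧ StrictMono ω}

instance : CoeFun Env (fun _ => ℤ → ℝ) := ⟨Subtype.val⟩

/-- The sigma-algebra generated by the coordinates. -/
instance : MeasurableSpace Env :=
  inferInstanceAs (MeasurableSpace {ω : ℤ → ℝ // ω 0 = 0 ∧ StrictMono ω})

/-- The `k`-th target: `ζ 1 + ⋯ + ζ k` for `0 ≤ k` and `-(ζ (k+1) + ⋯ + ζ 0)` for `k < 0`. -/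
def target (ζ : ℤ → Set.Ioi (0 : ℝ)) (k : ℤ) : ℝ :=
  ∑ i ∈ Finset.Ioc 0 k, (ζ i : ℝ) - ∑ i ∈ Finset.Ioc k 0, (ζ i : ℝ)

theorem target_zero (ζ : ℤ → Set.Ioi (0 : ℝ)) : target ζ 0 = 0 := by simp [target]

theorem target_eq_add (ζ : ℤ → Set.Ioi (0 : ℝ)) (k : ℤ) :
    target ζ k = target ζ (k - 1) + ζ k := by
  unfold target
  rcases le_or_gt k 0 with hk | hk
  · have h1 : Finset.Ioc 0 k = ∅ := Finset.Ioc_eq_empty (by omega)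
    have h2 : Finset.Ioc 0 (k - 1) = ∅ := Finset.Ioc_eq_empty (by omega)
    have h3 : Finset.Ioc (k - 1) 0 = insert k (Finset.Ioc k 0) := by
      ext i; simp only [Finset.mem_Ioc, Finset.mem_insert]; omega
    rw [h1, h2, h3, Finset.sum_insert (by simp)]; simp
  · have h1 : Finset.Ioc k 0 = ∅ := Finset.Ioc_eq_empty (by omega)
    have h2 : Finset.Ioc (k - 1) 0 = ∅ := Finset.Ioc_eq_empty (by omega)
    have h3 : Finset.Ioc 0 k = insert k (Finset.Ioc 0 (k - 1)) := by
      ext i; simp only [Finset.mem_Ioc, Finset.mem_insert]; omega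
    rw [h1, h2, h3, Finset.sum_insert (by simp)]; simp [add_comm]

theorem target_strictMono (ζ : ℤ → Set.Ioi (0 : ℝ)) : StrictMono (target ζ) := by
  refine strictMono_int_of_lt_succ fun k => ?_
  have h := target_eq_add ζ (k + 1)
  have h' : (0 : ℝ) < ζ (k + 1) := (ζ (k + 1)).2
  rw [add_sub_cancel_right] at h
  linarith

/-- The environment with gaps `ζ`: `ω 0 = 0` and `ω k = ω (k - 1) + ζ k` for all `k`. -/
def envOfGaps (ζ : ℤ → Set.Ioi (0 : ℝ)) : Env :=
  ⟨target ζ, target_zero ζ, target_strictMono ζ⟩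

theorem measurable_envOfGaps : Measurable envOfGaps := by
  refine Measurable.subtype_mk (measurable_pi_lambda _ fun k => ?_)
  unfold target
  fun_prop

/-- The law of the environment when the gaps are i.i.d. with law `ν` on `(0, ∞)`. -/
def envLaw (ν : Measure (Set.Ioi (0 : ℝ))) [IsProbabilityMeasure ν] : Measure Env :=
  (Measure.infinitePi fun _ : ℤ => ν).map envOfGaps

instance (ν : Measure (Set.Ioi (0 : ℝ))) [IsProbabilityMeasure ν] :
    IsProbabilityMeasure (envLaw ν) :=
  Measure.isProbabilityMeasure_map measurable_envOfGaps.aemeasurable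

/-- The mean gap. -/
def meanGap (ν : Measure (Set.Ioi (0 : ℝ))) : ℝ := ∫ z, (z : ℝ) ∂ν

/-! The underlying random walk -/

/-- `S 0 = 0` and `S n = ξ_1 + ⋯ + ξ_n`; the increment `ξ_{i+1}` is stored as `ξ i`. -/
def walkOfIncrements (ξ : ℕ → ℤ) (n : ℕ) : ℤ := ∑ i ∈ Finset.range n, ξ i

theorem measurable_walkOfIncrements : Measurable walkOfIncrements := by
  refine measurable_pi_lambda _ fun n => ?_
  unfold walkOfIncrements
  fun_prop

/-- The law on `ℤ^ℕ` of the walk started at `0` with i.i.d. increments of density `p`. -/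
def walkLaw (p : PMF ℤ) : Measure (ℕ → ℤ) :=
  (Measure.infinitePi fun _ : ℕ => p.toMeasure).map walkOfIncrements

instance (p : PMF ℤ) : IsProbabilityMeasure (walkLaw p) :=
  Measure.isProbabilityMeasure_map measurable_walkOfIncrements.aemeasurable

/-- The mean absolute jump `∑ |k| p_k`. -/
def meanAbsJump (p : PMF ℤ) : ℝ := ∑' k : ℤ, |(k : ℝ)| * (p k).toReal

/-- `E(|S_n|^q) / n^(q/2)`. -/
def normalizedMoment (p : PMF ℤ) (q : ℝ) (n : ℕ) : ℝ :=
  (∫ S, |(S n : ℝ)| ^ q ∂(walkLaw p)) / (n : ℝ) ^ (q / 2)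

/-- The limit `m_q` of `E(|S_n|^q) / n^(q/2)` as `n → ∞`. -/
def rescaledMoment (p : PMF ℤ) (q : ℝ) : ℝ := limUnder atTop (normalizedMoment p q)

/-! The continuous-time process -/

/-- The collision times: total length of the first `n` jumps of `n ↦ ω (S n)`. -/
def collisionTime (S : ℕ → ℤ) (ω : Env) (n : ℕ) : ℝ :=
  ∑ k ∈ Finset.range n, |ω (S (k + 1)) - ω (S k)|

/-- The index `n` such that `τ n ≤ t < τ (n + 1)`. -/
def collisionIndex (S : ℕ → ℤ) (ω : Env) (t : ℝ) : ℕ :=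
  sInf {n : ℕ | collisionTime S ω n ≤ t ∧ t < collisionTime S ω (n + 1)}

/-- `X(t) = ω_{S_n} + sgn(ξ_{n+1}) (t - τ(n))` for `t ∈ [τ(n), τ(n+1))`. -/
def position (S : ℕ → ℤ) (ω : Env) (t : ℝ) : ℝ :=
  ω (S (collisionIndex S ω t)) +
    ((S (collisionIndex S ω t + 1) - S (collisionIndex S ω t)).sign : ℝ) *
      (t - collisionTime S ω (collisionIndex S ω t))

theorem collisionTime_mono (S : ℕ → ℤ) (ω : Env) : Monotone (collisionTime S ω) := by
  refine monotone_nat_of_le_succ fun n => ?_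
  simp only [collisionTime, Finset.sum_range_succ]
  linarith [abs_nonneg (ω (S (n + 1)) - ω (S n))]

theorem collisionIndex_eq {S : ℕ → ℤ} {ω : Env} {t : ℝ} {n : ℕ}
    (h1 : collisionTime S ω n ≤ t) (h2 : t < collisionTime S ω (n + 1)) :
    collisionIndex S ω t = n := by
  have hset : {m : ℕ | collisionTime S ω m ≤ t ∧ t < collisionTime S ω (m + 1)} = {n} := by
    ext m
    simp only [Set.mem_ofPred_eq, Set.mem_singleton_iff]
    refine ⟨fun ⟨h3, h4⟩ => ?_, fun h => h ▸ ⟨h1, h2⟩⟩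
    rcases lt_trichotomy m n with h | h | h
    · linarith [collisionTime_mono S ω (show m + 1 ≤ n by omega)]
    · exact h
    · linarith [collisionTime_mono S ω (show n + 1 ≤ m by omega)]
  rw [collisionIndex, hset, csInf_singleton]

theorem position_eq {S : ℕ → ℤ} {ω : Env} {t : ℝ} {n : ℕ}
    (h1 : collisionTime S ω n ≤ t) (h2 : t < collisionTime S ω (n + 1)) :
    position S ω t = ω (S n) + ((S (n + 1) - S n).sign : ℝ) * (t - collisionTime S ω n) := by
  rw [position, collisionIndex_eq h1 h2]

theorem target_succ_eq (S : ℕ → ℤ) (ω : Env) (n : ℕ) :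
    ω (S (n + 1)) = ω (S n) +
      ((S (n + 1) - S n).sign : ℝ) * (collisionTime S ω (n + 1) - collisionTime S ω n) := by
  have h : collisionTime S ω (n + 1) - collisionTime S ω n = |ω (S (n + 1)) - ω (S n)| := by
    simp [collisionTime, Finset.sum_range_succ]
  rw [h]
  rcases lt_trichotomy (S n) (S (n + 1)) with h | h | h
  · rw [Int.sign_eq_one_of_pos (by omega), abs_of_pos (sub_pos.2 (ω.2.2 h))]; simp
  · simp [h]
  · rw [Int.sign_eq_neg_one_of_neg (by omega), abs_of_neg (sub_neg.2 (ω.2.2 h))]; simp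

theorem exists_index {S : ℕ → ℤ} {ω : Env} {t : ℝ} (ht : 0 ≤ t)
    (h : ∃ n, t < collisionTime S ω n) :
    ∃ n, collisionTime S ω n ≤ t ∧ t < collisionTime S ω (n + 1) := by
  classical
  have hpos : Nat.find h ≠ 0 := by
    intro h0
    have := Nat.find_spec h
    rw [h0] at this
    simp [collisionTime] at this
    linarith
  refine ⟨Nat.find h - 1, not_lt.1 (Nat.find_min h (by omega)), ?_⟩
  rw [Nat.sub_add_cancel (by omega)]
  exact Nat.find_spec h

/-- The affine formula of a piece also holds at its right end. -/
theorem position_eq_closed {S : ℕ → ℤ} {ω : Env} (h : ∀ t : ℝ, ∃ n, t < collisionTime S ω n)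
    {t : ℝ} (n : ℕ) (h1 : collisionTime S ω n ≤ t) (h2 : t ≤ collisionTime S ω (n + 1)) :
    position S ω t = ω (S n) + ((S (n + 1) - S n).sign : ℝ) * (t - collisionTime S ω n) := by
  have h0 : 0 ≤ t := le_trans (by
    have := collisionTime_mono S ω (Nat.zero_le n)
    simpa [collisionTime] using this) h1
  obtain ⟨m, hm1, hm2⟩ := exists_index h0 (h t)
  -- between the ends of piece `n` and the start of piece `m` the walk does not move
  have key : ∀ j, n ≤ j → j ≤ m → ω (S j) + ((S (j + 1) - S j).sign : ℝ) *
      (t - collisionTime S ω j) = ω (S n) + ((S (n + 1) - S n).sign : ℝ) *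
      (t - collisionTime S ω n) := by
    intro j hj
    induction j, hj using Nat.le_induction with
    | base => intro _; rfl
    | succ j hj ih =>
      intro hjm
      rw [← ih (by omega)]
      have h3 : collisionTime S ω (j + 1) = t :=
        le_antisymm ((collisionTime_mono S ω hjm).trans hm1)
          (h2.trans (collisionTime_mono S ω (by omega)))
      rw [target_succ_eq S ω j, h3]; simp
  rcases le_or_gt n m with hnm | hnm
  · rw [position_eq hm1 hm2, key m hnm le_rfl]
  · linarith [collisionTime_mono S ω (show m + 1 ≤ n by omega)]

theorem continuous_position {S : ℕ → ℤ} {ω : Env}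
    (h : ∀ t : ℝ, ∃ n, t < collisionTime S ω n) :
    Continuous fun t : ℝ≥0 => position S ω t := by
  refine LocallyFinite.continuous (f := fun n : ℕ => {t : ℝ≥0 |
    collisionTime S ω n ≤ t ∧ (t : ℝ) ≤ collisionTime S ω (n + 1)}) ?_ ?_ ?_ ?_
  · intro t
    obtain ⟨N, hN⟩ := h t
    refine ⟨{s : ℝ≥0 | (s : ℝ) < collisionTime S ω N},
      (isOpen_lt NNReal.continuous_coe continuous_const).mem_nhds hN, ?_⟩
    refine (Set.finite_lt_nat N).subset ?_
    rintro n ⟨s, ⟨hs1, _⟩, hs2⟩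
    simp only [Set.mem_ofPred_eq] at hs2 ⊢
    by_contra hn
    linarith [collisionTime_mono S ω (not_lt.1 hn)]
  · refine Set.eq_univ_of_forall fun t => Set.mem_iUnion.2 ?_
    obtain ⟨n, h1, h2⟩ := exists_index t.2 (h t)
    exact ⟨n, h1, h2.le⟩
  · intro n
    exact (isClosed_le continuous_const NNReal.continuous_coe).inter
      (isClosed_le NNReal.continuous_coe continuous_const)
  · intro n
    refine ContinuousOn.congr (f := fun t : ℝ≥0 => ω (S n) +
      ((S (n + 1) - S n).sign : ℝ) * ((t : ℝ) - collisionTime S ω n)) (by fun_prop) ?_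
    intro t ht
    exact position_eq_closed h n ht.1 ht.2

/-- The space of continuous paths from `[0, ∞)` to `ℝ`; on it the Skorokhod topology is
the topology of locally uniform convergence, which is the one that `C(ℝ≥0, ℝ)` carries. -/
abbrev PathSpace : Type := C(ℝ≥0, ℝ)

instance : MeasurableSpace PathSpace := borel _
instance : BorelSpace PathSpace := ⟨rfl⟩

/-- A map into the path space is measurable as soon as its coordinates are. -/
theorem measurable_of_eval {α : Type*} [MeasurableSpace α] {f : α → PathSpace}
    (hf : ∀ t, Measurable fun a => f a t) : Measurable f := by
  have hb : (borel PathSpace) = MeasurableSpace.generateFrom _ :=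
    borel_eq_generateFrom_of_subbasis ContinuousMap.compactOpen_eq
  rw [BorelSpace.measurable_eq (α := PathSpace), hb]
  refine measurable_generateFrom ?_
  rintro _ ⟨K, hK, U, hU, rfl⟩
  replace hU : IsOpen U := hU
  obtain ⟨D, hDK, hDc, hD⟩ := TopologicalSpace.IsSeparable.exists_countable_dense_subset
    (hK.isSeparable)
  have hset : f ⁻¹' {g : PathSpace | Set.MapsTo g K U} =
      ⋃ n : ℕ, ⋂ t ∈ D, {a | ((n : ENNReal) + 1)⁻¹ ≤ Metric.infEDist (f a t) Uᶜ} := by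
    ext a
    simp only [Set.mem_preimage, Set.mem_ofPred_eq, Set.mem_iUnion, Set.mem_iInter]
    constructor
    · intro h
      rcases K.eq_empty_or_nonempty with rfl | hne
      · exact ⟨0, fun t ht => absurd (hDK ht) (Set.notMem_empty t)⟩
      obtain ⟨t₀, ht₀, hmin⟩ := hK.exists_isMinOn hne
        ((Metric.continuous_infEDist (s := Uᶜ)).comp (f a).continuous).continuousOn
      have hne0 : Metric.infEDist (f a t₀) Uᶜ ≠ 0 := fun h0 =>
        (Metric.mem_iff_infEDist_zero_of_closed hU.isClosed_compl).2 h0 (h ht₀)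
      obtain ⟨n, hn⟩ := ENNReal.exists_inv_nat_lt hne0
      refine ⟨n, fun t ht => ?_⟩
      exact (ENNReal.inv_le_inv.2 le_self_add).trans (hn.le.trans (hmin (hDK ht)))
    · rintro ⟨n, hn⟩ t ht
      have hcl : IsClosed {t | ((n : ENNReal) + 1)⁻¹ ≤ Metric.infEDist (f a t) Uᶜ} :=
        isClosed_le continuous_const (Metric.continuous_infEDist.comp (f a).continuous)
      have hle : ((n : ENNReal) + 1)⁻¹ ≤ Metric.infEDist (f a t) Uᶜ :=
        closure_minimal (fun t ht => hn t ht) hcl (hD ht)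
      by_contra hU'
      have hz : Metric.infEDist (f a t) Uᶜ = 0 := Metric.infEDist_zero_of_mem hU'
      rw [hz] at hle
      simp at hle
  rw [hset]
  refine MeasurableSet.iUnion fun n => MeasurableSet.biInter hDc fun t _ => ?_
  exact measurableSet_le measurable_const (measurable_infEDist.comp (hf t))

open Classical in
/-- The trajectory `t ↦ X(t)` as a continuous path. The collision times are unbounded for
almost every `S`, whatever `ω`; on the remaining null set the path is set to `0`. -/
def path (S : ℕ → ℤ) (ω : Env) : PathSpace :=
  if h : ∀ t : ℝ, ∃ n, t < collisionTime S ω n then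
    ⟨fun t : ℝ≥0 => position S ω t, continuous_position h⟩
  else 0

theorem measurable_envEval {f : (ℕ → ℤ) × Env → ℤ} (hf : Measurable f) :
    Measurable fun x : (ℕ → ℤ) × Env => x.2 (f x) := by
  have h : Measurable fun y : ((ℕ → ℤ) × Env) × ℤ => y.1.2 y.2 :=
    measurable_from_prod_countable_left fun k =>
      (measurable_pi_apply k).comp (measurable_subtype_coe.comp measurable_snd)
  exact h.comp (measurable_id.prodMk hf)

theorem measurable_walkEval (n : ℕ) : Measurable fun x : (ℕ → ℤ) × Env => x.1 n :=
  (measurable_pi_apply n).comp measurable_fst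

theorem measurable_collisionTime (n : ℕ) :
    Measurable fun x : (ℕ → ℤ) × Env => collisionTime x.1 x.2 n := by
  unfold collisionTime
  refine Finset.measurable_sum _ fun k _ => ?_
  exact ((measurable_envEval (measurable_walkEval (k + 1))).sub
    (measurable_envEval (measurable_walkEval k))).abs

theorem measurable_collisionIndex (t : ℝ) :
    Measurable fun x : (ℕ → ℤ) × Env => collisionIndex x.1 x.2 t := by
  have hA : ∀ n, MeasurableSet {x : (ℕ → ℤ) × Env |
      collisionTime x.1 x.2 n ≤ t ∧ t < collisionTime x.1 x.2 (n + 1)} := fun n =>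
    (measurableSet_le (measurable_collisionTime n) measurable_const).inter
      (measurableSet_lt measurable_const (measurable_collisionTime (n + 1)))
  refine measurable_to_countable' fun n => ?_
  have hset : (fun x : (ℕ → ℤ) × Env => collisionIndex x.1 x.2 t) ⁻¹' {n} =
      {x | collisionTime x.1 x.2 n ≤ t ∧ t < collisionTime x.1 x.2 (n + 1)} ∪
      ((⋂ m, {x : (ℕ → ℤ) × Env |
        collisionTime x.1 x.2 m ≤ t ∧ t < collisionTime x.1 x.2 (m + 1)}ᶜ) ∩ {_x | n = 0}) := by
    ext x
    simp only [Set.mem_preimage, Set.mem_singleton_iff, Set.mem_union, Set.mem_inter_iff,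
      Set.mem_iInter, Set.mem_compl_iff, Set.mem_ofPred_eq]
    constructor
    · intro hx
      by_cases hex : ∃ m, collisionTime x.1 x.2 m ≤ t ∧ t < collisionTime x.1 x.2 (m + 1)
      · obtain ⟨m, hm⟩ := hex
        rw [collisionIndex_eq hm.1 hm.2] at hx
        exact Or.inl (hx ▸ hm)
      · refine Or.inr ⟨fun m hm => hex ⟨m, hm⟩, ?_⟩
        rw [← hx, collisionIndex, Nat.sInf_eq_zero]
        exact Or.inr (Set.eq_empty_of_forall_notMem fun m hm => hex ⟨m, hm⟩)
    · rintro (hx | ⟨hx, rfl⟩)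
      · exact collisionIndex_eq hx.1 hx.2
      · rw [collisionIndex, Nat.sInf_eq_zero]
        exact Or.inr (Set.eq_empty_of_forall_notMem fun m hm => hx m hm)
  rw [hset]
  exact (hA n).union ((MeasurableSet.iInter fun m => (hA m).compl).inter (MeasurableSet.const _))

theorem measurable_position (t : ℝ) :
    Measurable fun x : (ℕ → ℤ) × Env => position x.1 x.2 t := by
  have h : Measurable fun y : ((ℕ → ℤ) × Env) × ℕ => y.1.2 (y.1.1 y.2) +
      ((y.1.1 (y.2 + 1) - y.1.1 y.2).sign : ℝ) * (t - collisionTime y.1.1 y.1.2 y.2) := by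
    refine measurable_from_prod_countable_left fun n => ?_
    have hs : Measurable fun k : ℤ => ((k.sign : ℤ) : ℝ) := measurable_from_top
    exact (measurable_envEval (measurable_walkEval n)).add
      ((hs.comp ((measurable_walkEval (n + 1)).sub (measurable_walkEval n))).mul
        (measurable_const.sub (measurable_collisionTime n)))
  exact h.comp (measurable_id.prodMk (measurable_collisionIndex t))

theorem measurable_path : Measurable fun x : (ℕ → ℤ) × Env => path x.1 x.2 := by
  classical
  refine measurable_of_eval fun t => ?_
  have hset : MeasurableSet {x : (ℕ → ℤ) × Env | ∀ s : ℝ, ∃ n, s < collisionTime x.1 x.2 n} := by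
    have heq : {x : (ℕ → ℤ) × Env | ∀ s : ℝ, ∃ n, s < collisionTime x.1 x.2 n} =
        ⋂ N : ℕ, ⋃ n : ℕ, {x | (N : ℝ) < collisionTime x.1 x.2 n} := by
      ext x
      simp only [Set.mem_iInter, Set.mem_iUnion, Set.mem_ofPred_eq]
      refine ⟨fun h N => h N, fun h s => ?_⟩
      obtain ⟨N, hN⟩ := exists_nat_gt s
      obtain ⟨n, hn⟩ := h N
      exact ⟨n, hN.trans hn⟩
    rw [heq]
    exact MeasurableSet.iInter fun N => MeasurableSet.iUnion fun n =>
      measurableSet_lt measurable_const (measurable_collisionTime n)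
  have heval : (fun x : (ℕ → ℤ) × Env => path x.1 x.2 t) = fun x =>
      if ∀ s : ℝ, ∃ n, s < collisionTime x.1 x.2 n then position x.1 x.2 t else 0 := by
    funext x
    unfold path
    split_ifs <;> rfl
  rw [heval]
  exact Measurable.ite hset (measurable_position t) measurable_const

/-- The quenched law: the law of `X` on the path space for a fixed environment, as a
measurable function of the environment. -/
def quenchedLaw (p : PMF ℤ) : Kernel Env PathSpace where
  toFun ω := (walkLaw p).map fun S => path S ω
  measurable' := by
    have h : ∀ ω : Env, (walkLaw p).map (fun S => path S ω) =
        ((walkLaw p).map fun S => (S, ω)).map fun x => path x.1 x.2 := fun ω => by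
      rw [Measure.map_map measurable_path measurable_prodMk_right]; rfl
    simp_rw [h]
    exact (Measure.measurable_map _ measurable_path).comp Measurable.map_prodMk_right

instance (p : PMF ℤ) : IsMarkovKernel (quenchedLaw p) where
  isProbabilityMeasure _ := Measure.isProbabilityMeasure_map
    (measurable_path.comp (measurable_id.prodMk measurable_const)).aemeasurable

/-- The annealed law on `PathSpace × Env`; see `annealedLaw_prod`. -/
def annealedLaw (ν : Measure (Set.Ioi (0 : ℝ))) [IsProbabilityMeasure ν] (p : PMF ℤ) :
    Measure (PathSpace × Env) :=
  ((envLaw ν) ⊗ₘ (quenchedLaw p)).map Prod.swap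

instance (ν : Measure (Set.Ioi (0 : ℝ))) [IsProbabilityMeasure ν] (p : PMF ℤ) :
    IsProbabilityMeasure (annealedLaw ν p) :=
  Measure.isProbabilityMeasure_map measurable_swap.aemeasurable

/-- The defining formula of the annealed law. -/
theorem annealedLaw_prod (ν : Measure (Set.Ioi (0 : ℝ))) [IsProbabilityMeasure ν] (p : PMF ℤ)
    {G : Set PathSpace} {F : Set Env} (hG : MeasurableSet G) (hF : MeasurableSet F) :
    annealedLaw ν p (G ×ˢ F) = ∫⁻ ω in F, quenchedLaw p ω G ∂(envLaw ν) := by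
  rw [annealedLaw, Measure.map_apply measurable_swap (hG.prod hF), Set.preimage_swap_prod,
    Measure.compProd_apply_prod hF hG]

end LevyWalk

end

/-!
The travel time to the `n`-th collision is the sum of all gaps, each weighted by the number of
times the first `n` jumps cross it. By the central limit theorem two jumps made at distant times
rarely cross the same gap, so the sum of the squared weights is `o(n²)` and a weak law of large
numbers for this random scenery gives `τ n / n → μ m̄` in probability. Since `τ` is monotone, the
number of collisions up to time `t` is `t / (μ m̄)` to first order. Kolmogorov's maximal
inequality allows the walk at this random index to be replaced by the walk at the deterministic
index `⌊t / (μ m̄)⌋` at the cost of `o(√t)`, and the law of large numbers for the gaps turns `ω k`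
into `μ k + o(|k|)`. Hence `X t` and `μ S_⌊t / (μ m̄)⌋` differ by `o(√t)` in probability, and the
limit is that of a centred random walk with finite variance.
-/

namespace LevyWalk

section ConvergenceInMeasure

variable {Ω ι E F : Type*} {mΩ : MeasurableSpace Ω} {P : Measure Ω} {l : Filter ι}

theorem tendstoInMeasure_of_ae_tendsto [IsFiniteMeasure P] [PseudoEMetricSpace E]
    [l.IsCountablyGenerated] {f : ι → Ω → E} {g : Ω → E}
    (hf : ∀ i, AEStronglyMeasurable (f i) P)
    (hfg : ∀ᵐ ω ∂P, Tendsto (fun i => f i ω) l (𝓝 (g ω))) : TendstoInMeasure P f l g :=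
  fun ε hε => tendsto_of_seq_tendsto fun u hu =>
    tendstoInMeasure_of_tendsto_ae (fun n => hf (u n)) (hfg.mono fun _ h => h.comp hu) ε hε

theorem tendstoInMeasure_add [SeminormedAddCommGroup E] {f g : ι → Ω → E} {f' g' : Ω → E}
    (hf : TendstoInMeasure P f l f') (hg : TendstoInMeasure P g l g') :
    TendstoInMeasure P (fun i ω => f i ω + g i ω) l (fun ω => f' ω + g' ω) := by
  intro ε hε
  have hsum := (hf (ε / 2) (ENNReal.half_pos hε.ne')).add (hg (ε / 2) (ENNReal.half_pos hε.ne'))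
  rw [add_zero] at hsum
  refine tendsto_of_tendsto_of_tendsto_of_le_of_le tendsto_const_nhds hsum (fun _ => zero_le) ?_
  refine fun i => (measure_mono fun ω hω => ?_).trans (measure_union_le _ _)
  by_contra hsmall
  simp only [Set.mem_union, Set.mem_ofPred_eq, not_or, not_le] at hsmall hω
  exact (hω.trans (edist_add_add_le _ _ _ _)).not_gt
    ((ENNReal.add_lt_add hsmall.1 hsmall.2).trans_eq (ENNReal.add_halves ε))

theorem tendstoInMeasure_zero_of_norm_le_mul [SeminormedAddCommGroup E] [SeminormedAddCommGroup F]
    {f : ι → Ω → E} {g : ι → Ω → F} {C : ℝ} (hg : TendstoInMeasure P g l fun _ => 0)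
    (hfg : ∀ᶠ i in l, ∀ᵐ ω ∂P, ‖f i ω‖ ≤ C * ‖g i ω‖) : TendstoInMeasure P f l fun _ => 0 := by
  simp only [tendstoInMeasure_iff_norm, sub_zero] at hg ⊢
  intro ε hε
  have hC : 0 < |C| + 1 := by positivity
  refine tendsto_of_tendsto_of_tendsto_of_le_of_le' tendsto_const_nhds
    (hg (ε / (|C| + 1)) (div_pos hε hC)) (Eventually.of_forall fun _ => zero_le) ?_
  filter_upwards [hfg] with i hi
  refine measure_mono_ae ?_
  filter_upwards [hi] with ω hω (hε_le : ε ≤ ‖f i ω‖)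
  change ε / (|C| + 1) ≤ ‖g i ω‖
  rw [div_le_iff₀' hC]
  calc ε ≤ C * ‖g i ω‖ := hε_le.trans hω
    _ ≤ (|C| + 1) * ‖g i ω‖ := by gcongr; linarith [le_abs_self C]

theorem tendstoInMeasure_norm [SeminormedAddCommGroup E] {f : ι → Ω → E}
    (hf : TendstoInMeasure P f l fun _ => 0) :
    TendstoInMeasure P (fun i ω => ‖f i ω‖) l fun _ => 0 :=
  tendstoInMeasure_zero_of_norm_le_mul (C := 1) hf
    (Eventually.of_forall fun _ => ae_of_all _ fun _ => by simp)

theorem tendstoInMeasure_const_mul {f : ι → Ω → ℝ} (c : ℝ)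
    (hf : TendstoInMeasure P f l fun _ => 0) :
    TendstoInMeasure P (fun i ω => c * f i ω) l fun _ => 0 :=
  tendstoInMeasure_zero_of_norm_le_mul (C := |c|) hf
    (Eventually.of_forall fun _ => ae_of_all _ fun _ => by simp)

theorem tendsto_measureReal_le_of_lt [IsFiniteMeasure P] {Y : ι → Ω → ℝ} {c x : ℝ} {a : ι → ℝ}
    (hY : TendstoInMeasure P Y l fun _ => c) (ha : Tendsto a l (𝓝 x)) (hx : x < c) :
    Tendsto (fun i => P.real {ω | Y i ω ≤ a i}) l (𝓝 0) := by
  refine squeeze_zero' (Eventually.of_forall fun _ => measureReal_nonneg) ?_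
    (tendstoInMeasure_iff_measureReal_norm.1 hY ((c - x) / 2) (by linarith))
  filter_upwards [ha.eventually_lt_const (show x < (c + x) / 2 by linarith)] with i hi
  refine measureReal_mono fun ω (hω : Y i ω ≤ a i) => ?_
  change (c - x) / 2 ≤ |Y i ω - c|
  linarith [neg_le_abs (Y i ω - c)]

theorem tendsto_measureReal_ge_of_gt [IsFiniteMeasure P] {Y : ι → Ω → ℝ} {c x : ℝ} {a : ι → ℝ}
    (hY : TendstoInMeasure P Y l fun _ => c) (ha : Tendsto a l (𝓝 x)) (hx : c < x) :
    Tendsto (fun i => P.real {ω | a i ≤ Y i ω}) l (𝓝 0) := by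
  refine squeeze_zero' (Eventually.of_forall fun _ => measureReal_nonneg) ?_
    (tendstoInMeasure_iff_measureReal_norm.1 hY ((x - c) / 2) (by linarith))
  filter_upwards [ha.eventually_const_lt (show (c + x) / 2 < x by linarith)] with i hi
  refine measureReal_mono fun ω (hω : a i ≤ Y i ω) => ?_
  change (x - c) / 2 ≤ |Y i ω - c|
  linarith [le_abs_self (Y i ω - c)]

theorem tendsto_zero_of_forall_eventually_le_add {f : ι → ℝ} (hf : ∀ i, 0 ≤ f i)
    (h : ∀ η > 0, ∃ g : ι → ℝ, Tendsto g l (𝓝 0) ∧ ∀ᶠ i in l, f i ≤ η + g i) :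
    Tendsto f l (𝓝 0) := by
  refine tendsto_order.2 ⟨fun a ha => Eventually.of_forall fun i => ha.trans_le (hf i), ?_⟩
  intro a ha
  obtain ⟨g, hg, hfg⟩ := h (a / 2) (half_pos ha)
  filter_upwards [hfg, hg.eventually_lt_const (half_pos ha)] with i h1 h2
  linarith

theorem sq_mul_measureReal_le_integral_sq {Z : Ω → ℝ} (hZ : MemLp Z 2 P) {a : ℝ} (ha : 0 ≤ a) :
    a ^ 2 * P.real {ω | a ≤ |Z ω|} ≤ ∫ ω, Z ω ^ 2 ∂P := by
  have hset : {ω | a ≤ |Z ω|} = {ω | a ^ 2 ≤ Z ω ^ 2} := by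
    ext ω
    simp only [Set.mem_ofPred_eq, sq_le_sq, abs_of_nonneg ha]
  rw [hset]
  exact mul_meas_ge_le_integral_of_nonneg (ae_of_all _ fun ω => sq_nonneg (Z ω)) hZ.integrable_sq _

theorem tendstoInMeasure_zero_of_abs_le_mul_add [IsFiniteMeasure P] {Y Z : ι → Ω → ℝ} {K : ℝ}
    (hZ : ∀ i, MemLp (Z i) 2 P) (hK : ∀ᶠ i in l, ∫ ω, Z i ω ^ 2 ∂P ≤ K)
    (hY : ∀ ε > 0, ∃ R : ι → Ω → ℝ, TendstoInMeasure P R l (fun _ => 0) ∧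
      ∀ᶠ i in l, ∀ᵐ ω ∂P, |Y i ω| ≤ ε * |Z i ω| + R i ω) :
    TendstoInMeasure P Y l fun _ => 0 := by
  simp only [tendstoInMeasure_iff_measureReal_norm, sub_zero, Real.norm_eq_abs]
  intro a ha
  refine tendsto_zero_of_forall_eventually_le_add (fun _ => measureReal_nonneg) fun η hη => ?_
  -- Chebyshev's inequality at level `b` costs `K / b ^ 2 ≤ η`.
  obtain ⟨b, hb, hbK⟩ : ∃ b > 0, K ≤ b ^ 2 * η := by
    refine ⟨√(|K| / η) + 1, by positivity, ?_⟩
    have hsq := Real.sq_sqrt (show 0 ≤ |K| / η by positivity)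
    have : |K| / η ≤ (√(|K| / η) + 1) ^ 2 := by nlinarith [Real.sqrt_nonneg (|K| / η)]
    exact (le_abs_self K).trans ((div_le_iff₀ hη).1 this)
  obtain ⟨R, hR, hYR⟩ := hY (a / (2 * b)) (by positivity)
  refine ⟨_, tendstoInMeasure_iff_measureReal_norm.1 hR (a / 2) (by positivity), ?_⟩
  filter_upwards [hK, hYR] with i hKi hYi
  have hZη : P.real {ω | b ≤ |Z i ω|} ≤ η :=
    le_of_mul_le_mul_left ((sq_mul_measureReal_le_integral_sq (hZ i) hb.le).trans
      (hKi.trans hbK)) (by positivity)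
  have hsub : ∀ᵐ ω ∂P, ω ∈ {ω | a ≤ |Y i ω|} →
      ω ∈ {ω | b ≤ |Z i ω|} ∪ {ω | a / 2 ≤ ‖R i ω - 0‖} := by
    filter_upwards [hYi] with ω hω (haY : a ≤ |Y i ω|)
    by_contra hsmall
    simp only [Set.mem_union, Set.mem_ofPred_eq, sub_zero, Real.norm_eq_abs, not_or,
      not_le] at hsmall
    have hab : a / (2 * b) * |Z i ω| < a / 2 := by
      calc a / (2 * b) * |Z i ω| < a / (2 * b) * b := by gcongr; exact hsmall.1
        _ = a / 2 := by field_simp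
    linarith [le_abs_self (R i ω)]
  calc P.real {ω | a ≤ |Y i ω|}
      ≤ P.real ({ω | b ≤ |Z i ω|} ∪ {ω | a / 2 ≤ ‖R i ω - 0‖}) :=
        ENNReal.toReal_mono (measure_ne_top _ _) (measure_mono_ae hsub)
    _ ≤ _ := (measureReal_union_le _ _).trans (by gcongr)

end ConvergenceInMeasure

section IndependentSums

variable {Ω ι : Type*} {mΩ : MeasurableSpace Ω} {P : Measure Ω}

theorem integral_sq_sum [IsProbabilityMeasure P] {X : ι → Ω → ℝ} (hX2 : ∀ i, MemLp (X i) 2 P)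
    (hind : Pairwise fun i j => X i ⟂ᵢ[P] X j) (hX0 : ∀ i, P[X i] = 0) (s : Finset ι) :
    ∫ ω, (∑ i ∈ s, X i ω) ^ 2 ∂P = ∑ i ∈ s, Var[X i; P] := by
  have hmean : P[∑ i ∈ s, X i] = 0 := by
    simp only [Finset.sum_apply]
    rw [integral_finsetSum _ fun i _ => (hX2 i).integrable one_le_two]
    exact Finset.sum_eq_zero fun i _ => hX0 i
  rw [← IndepFun.variance_sum (fun i _ => hX2 i) fun i _ j _ hij => hind hij,
    variance_of_integral_eq_zero (memLp_finsetSum' _ fun i _ => hX2 i).aemeasurable hmean]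
  simp only [Finset.sum_apply]

variable {X : ℕ → Ω → ℝ}

theorem submartingale_sq_sum (hX : ∀ i, StronglyMeasurable (X i)) (hX2 : ∀ i, MemLp (X i) 2 P)
    (hind : iIndepFun X P) (hX0 : ∀ i, P[X i] = 0) :
    Submartingale (fun n ω => (∑ i ∈ Finset.range (n + 1), X i ω) ^ 2)
      (Filtration.natural X hX) P := by
  have := hind.isProbabilityMeasure
  have hsum2 (n : ℕ) : MemLp (fun ω => ∑ i ∈ Finset.range n, X i ω) 2 P :=
    memLp_finsetSum _ fun i _ => hX2 i
  have hadapted (n : ℕ) : StronglyMeasurable[Filtration.natural X hX n]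
      fun ω => ∑ i ∈ Finset.range (n + 1), X i ω :=
    Finset.stronglyMeasurable_fun_sum _ fun i hi =>
      (Filtration.stronglyAdapted_natural hX i).mono
        ((Filtration.natural X hX).mono (Finset.mem_range_succ_iff.1 hi))
  have hprod (n : ℕ) : Integrable
      ((fun ω => 2 * ∑ i ∈ Finset.range (n + 1), X i ω) * X (n + 1)) P :=
    ((hsum2 (n + 1)).const_mul 2).integrable_mul (hX2 (n + 1))
  refine submartingale_of_condExp_sub_nonneg_nat (fun n => (hadapted n).pow 2)
    (fun n => (hsum2 (n + 1)).integrable_sq) fun n => ?_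
  -- `S (n + 1) ^ 2 - S n ^ 2 = 2 * S n * X (n + 1) + X (n + 1) ^ 2`
  have hdiff : (fun ω => (∑ i ∈ Finset.range (n + 1 + 1), X i ω) ^ 2) -
      (fun ω => (∑ i ∈ Finset.range (n + 1), X i ω) ^ 2) =
      (fun ω => 2 * ∑ i ∈ Finset.range (n + 1), X i ω) * X (n + 1) +
        fun ω => X (n + 1) ω ^ 2 := by
    funext ω
    simp only [Pi.sub_apply, Pi.add_apply, Pi.mul_apply, Finset.sum_range_succ _ (n + 1)]
    ring
  rw [hdiff]
  filter_upwards [condExp_add (hprod n) (hX2 (n + 1)).integrable_sq (Filtration.natural X hX n),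
    condExp_mul_of_stronglyMeasurable_left ((hadapted n).const_mul 2) (hprod n)
      ((hX2 (n + 1)).integrable one_le_two),
    hind.condExp_natural_ae_eq_of_lt hX (Nat.lt_succ_self n),
    condExp_nonneg (m := Filtration.natural X hX n) (μ := P)
      (ae_of_all P fun ω => sq_nonneg (X (n + 1) ω))] with ω hadd hpull hindep hsq
  rw [hadd, Pi.add_apply, hpull, Pi.mul_apply, hindep, Pi.zero_apply, hX0]
  simpa using hsq

theorem sq_mul_measureReal_exists_le_abs_sum_le (hX : ∀ i, StronglyMeasurable (X i))
    (hX2 : ∀ i, MemLp (X i) 2 P) (hind : iIndepFun X P) (hX0 : ∀ i, P[X i] = 0) {a : ℝ}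
    (ha : 0 < a) (n : ℕ) :
    a ^ 2 * P.real {ω | ∃ k ≤ n, a ≤ |∑ i ∈ Finset.range k, X i ω|} ≤
      ∑ i ∈ Finset.range n, Var[X i; P] := by
  have := hind.isProbabilityMeasure
  rcases n with _ | n
  · simp [ha.not_ge]
  set maxLarge : Set Ω := {ω | a ^ 2 ≤ (Finset.range (n + 1)).sup'
    Finset.nonempty_range_add_one fun k => (∑ i ∈ Finset.range (k + 1), X i ω) ^ 2}
  have hsubset : {ω | ∃ k ≤ n + 1, a ≤ |∑ i ∈ Finset.range k, X i ω|} ⊆ maxLarge := by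
    rintro ω ⟨_ | k, hk, hak⟩
    · simp [ha.not_ge] at hak
    · have hak' : a ^ 2 ≤ (∑ i ∈ Finset.range (k + 1), X i ω) ^ 2 := by
        rwa [sq_le_sq, abs_of_pos ha]
      exact hak'.trans (Finset.le_sup' (fun k => (∑ i ∈ Finset.range (k + 1), X i ω) ^ 2)
        (Finset.mem_range.2 hk))
  have hdoob : a ^ 2 * P.real maxLarge ≤
      ∫ ω in maxLarge, (∑ i ∈ Finset.range (n + 1), X i ω) ^ 2 ∂P := by
    have h := ENNReal.toReal_mono ENNReal.ofReal_ne_top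
      (maximal_ineq (submartingale_sq_sum hX hX2 hind hX0) (fun _ _ => sq_nonneg _)
        (ε := (a ^ 2).toNNReal) n)
    rwa [Real.coe_toNNReal _ (sq_nonneg a), ENNReal.toReal_mul,
      ENNReal.toReal_ofReal (integral_nonneg fun _ => sq_nonneg _), ENNReal.coe_toReal,
      Real.coe_toNNReal _ (sq_nonneg a)] at h
  have hint : Integrable (fun ω => (∑ i ∈ Finset.range (n + 1), X i ω) ^ 2) P :=
    (memLp_finsetSum _ fun i _ => hX2 i).integrable_sq
  calc a ^ 2 * P.real {ω | ∃ k ≤ n + 1, a ≤ |∑ i ∈ Finset.range k, X i ω|}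
      ≤ a ^ 2 * P.real maxLarge :=
        mul_le_mul_of_nonneg_left (measureReal_mono hsubset) (sq_nonneg a)
    _ ≤ ∫ ω in maxLarge, (∑ i ∈ Finset.range (n + 1), X i ω) ^ 2 ∂P := hdoob
    _ ≤ ∫ ω, (∑ i ∈ Finset.range (n + 1), X i ω) ^ 2 ∂P :=
      setIntegral_le_integral hint (ae_of_all _ fun ω => sq_nonneg _)
    _ = ∑ i ∈ Finset.range (n + 1), Var[X i; P] :=
      integral_sq_sum hX2 (fun _ _ hij => hind.indepFun hij) hX0 _

end IndependentSums

section RandomIndices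

variable {Ω : Type*} {mΩ : MeasurableSpace Ω} {P : Measure Ω}

theorem abs_div_sub_lt_index_mem_window {θ δ t : ℝ} (ht : 0 < t) {n : ℕ}
    (hn : |(n : ℝ) / t - θ| < δ) : ∃ k ≤ ⌊2 * δ * t⌋₊ + 2, n = ⌊(θ - δ) * t⌋₊ + k := by
  rw [abs_lt, lt_sub_iff_add_lt, sub_lt_iff_lt_add, lt_div_iff₀ ht, div_lt_iff₀ ht] at hn
  have hlow : ⌊(θ - δ) * t⌋₊ ≤ n := Nat.floor_le_of_le (by linarith)
  refine ⟨n - ⌊(θ - δ) * t⌋₊, ?_, (Nat.add_sub_cancel' hlow).symm⟩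
  have h1 := Nat.lt_floor_add_one ((θ - δ) * t)
  have h2 := Nat.lt_floor_add_one (2 * δ * t)
  have : (n : ℝ) < (⌊(θ - δ) * t⌋₊ + (⌊2 * δ * t⌋₊ + 2) : ℕ) := by
    push_cast
    linarith
  have := Nat.cast_lt.1 this
  omega

theorem sq_mul_measureReal_sum_sub_sum_le {X : ℕ → Ω → ℝ} (hX : ∀ i, StronglyMeasurable (X i))
    (hX2 : ∀ i, MemLp (X i) 2 P) (hind : iIndepFun X P) (hX0 : ∀ i, P[X i] = 0) {v : ℝ}
    (hvar : ∀ i, Var[X i; P] ≤ v) {ε : ℝ} (hε : 0 < ε) (a L : ℕ) :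
    (ε / 2) ^ 2 * P.real {ω | ∃ k ≤ L, ∃ l ≤ L,
      ε ≤ |∑ i ∈ Finset.range (a + k), X i ω - ∑ i ∈ Finset.range (a + l), X i ω|} ≤ L * v := by
  have := hind.isProbabilityMeasure
  have hsub : {ω | ∃ k ≤ L, ∃ l ≤ L,
      ε ≤ |∑ i ∈ Finset.range (a + k), X i ω - ∑ i ∈ Finset.range (a + l), X i ω|} ⊆
      {ω | ∃ k ≤ L, ε / 2 ≤ |∑ i ∈ Finset.range k, X (a + i) ω|} := by
    rintro ω ⟨k, hk, l, hl, hkl⟩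
    rw [Finset.sum_range_add, Finset.sum_range_add, add_sub_add_left_eq_sub] at hkl
    by_contra! hsmall
    have hk' := lt_of_not_ge fun h => hsmall ⟨k, hk, h⟩
    have hl' := lt_of_not_ge fun h => hsmall ⟨l, hl, h⟩
    linarith [abs_sub (∑ i ∈ Finset.range k, X (a + i) ω) (∑ i ∈ Finset.range l, X (a + i) ω)]
  calc _ ≤ (ε / 2) ^ 2 * P.real {ω | ∃ k ≤ L, ε / 2 ≤ |∑ i ∈ Finset.range k, X (a + i) ω|} :=
        mul_le_mul_of_nonneg_left (measureReal_mono hsub) (sq_nonneg _)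
    _ ≤ ∑ i ∈ Finset.range L, Var[X (a + i); P] :=
        sq_mul_measureReal_exists_le_abs_sum_le (fun i => hX (a + i)) (fun i => hX2 (a + i))
          (hind.precomp (add_right_injective a)) (fun i => hX0 (a + i)) (half_pos hε) L
    _ ≤ L * v := by
        simpa using Finset.sum_le_card_nsmul (Finset.range L) _ v fun i _ => hvar (a + i)

theorem measureReal_exists_sum_sub_sum_le {X : ℕ → Ω → ℝ} (hX : ∀ i, StronglyMeasurable (X i))
    (hX2 : ∀ i, MemLp (X i) 2 P) (hind : iIndepFun X P) (hX0 : ∀ i, P[X i] = 0) {v : ℝ}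
    (hvar : ∀ i, Var[X i; P] ≤ v) {ε δ t : ℝ} (hε : 0 < ε) (hδ : 0 ≤ δ) (ht : 0 < t) (θ : ℝ) :
    P.real {ω | ∃ m n : ℕ, |(m : ℝ) / t - θ| < δ ∧ |(n : ℝ) / t - θ| < δ ∧
      ε * √t ≤ |∑ i ∈ Finset.range m, X i ω - ∑ i ∈ Finset.range n, X i ω|} ≤
      8 * δ * v / ε ^ 2 + 8 * v / ε ^ 2 * t⁻¹ := by
  have := hind.isProbabilityMeasure
  have hv : 0 ≤ v := (variance_nonneg (X 0) P).trans (hvar 0)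
  set a := ⌊(θ - δ) * t⌋₊
  set L := ⌊2 * δ * t⌋₊ + 2
  have hL : (L : ℝ) ≤ 2 * δ * t + 2 := by
    push_cast [L]
    gcongr
    exact Nat.floor_le (by positivity)
  have hkolmogorov := sq_mul_measureReal_sum_sub_sum_le hX hX2 hind hX0 hvar
    (mul_pos hε (Real.sqrt_pos.2 ht)) a L
  have hsq : (ε * √t / 2) ^ 2 = ε ^ 2 * t / 4 := by
    rw [div_pow, mul_pow, Real.sq_sqrt ht.le]
    norm_num
  rw [hsq, ← le_div_iff₀' (by positivity)] at hkolmogorov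
  calc _ ≤ P.real {ω | ∃ k ≤ L, ∃ l ≤ L, ε * √t ≤
        |∑ i ∈ Finset.range (a + k), X i ω - ∑ i ∈ Finset.range (a + l), X i ω|} := by
        refine measureReal_mono ?_
        rintro ω ⟨m, n, hm, hn, hmn⟩
        obtain ⟨k, hk, rfl⟩ := abs_div_sub_lt_index_mem_window ht hm
        obtain ⟨l, hl, rfl⟩ := abs_div_sub_lt_index_mem_window ht hn
        exact ⟨k, hk, l, hl, hmn⟩
    _ ≤ (2 * δ * t + 2) * v / (ε ^ 2 * t / 4) := hkolmogorov.trans (by gcongr)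
    _ = _ := by field_simp; ring

theorem tendstoInMeasure_sum_sub_sum_div_sqrt {X : ℕ → Ω → ℝ}
    (hX : ∀ i, StronglyMeasurable (X i)) (hX2 : ∀ i, MemLp (X i) 2 P) (hind : iIndepFun X P)
    (hX0 : ∀ i, P[X i] = 0) {v : ℝ} (hvar : ∀ i, Var[X i; P] ≤ v) {θ : ℝ}
    {m n : ℝ → Ω → ℕ} (hm : TendstoInMeasure P (fun t ω => (m t ω : ℝ) / t) atTop fun _ => θ)
    (hn : TendstoInMeasure P (fun t ω => (n t ω : ℝ) / t) atTop fun _ => θ) :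
    TendstoInMeasure P (fun t ω =>
      (∑ i ∈ Finset.range (m t ω), X i ω - ∑ i ∈ Finset.range (n t ω), X i ω) / √t)
      atTop fun _ => 0 := by
  have := hind.isProbabilityMeasure
  have hv : 0 ≤ v := (variance_nonneg (X 0) P).trans (hvar 0)
  simp only [tendstoInMeasure_iff_measureReal_norm, Real.norm_eq_abs, sub_zero] at hm hn ⊢
  intro ε hε
  refine tendsto_zero_of_forall_eventually_le_add (fun _ => measureReal_nonneg) fun η hη => ?_
  obtain ⟨δ, hδ, hδη⟩ : ∃ δ > 0, 8 * δ * v / ε ^ 2 ≤ η := by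
    refine ⟨η * ε ^ 2 / (8 * (v + 1)), by positivity, ?_⟩
    rw [div_le_iff₀ (by positivity)]
    calc 8 * (η * ε ^ 2 / (8 * (v + 1))) * v = η * ε ^ 2 * (v / (v + 1)) := by field_simp
      _ ≤ η * ε ^ 2 * 1 := by gcongr; exact (div_le_one (by positivity)).2 (by linarith)
      _ = η * ε ^ 2 := mul_one _
  refine ⟨fun t => 8 * v / ε ^ 2 * t⁻¹ + (P.real {ω | δ ≤ |(m t ω : ℝ) / t - θ|} +
    P.real {ω | δ ≤ |(n t ω : ℝ) / t - θ|}), ?_, ?_⟩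
  · simpa using (tendsto_inv_atTop_zero.const_mul (8 * v / ε ^ 2)).add ((hm δ hδ).add (hn δ hδ))
  filter_upwards [eventually_gt_atTop 0] with t ht
  have hwindow := measureReal_exists_sum_sub_sum_le hX hX2 hind hX0 hvar hε hδ.le ht θ
  refine (measureReal_mono (s₂ := _ ∪ ({ω | δ ≤ |(m t ω : ℝ) / t - θ|} ∪
    {ω | δ ≤ |(n t ω : ℝ) / t - θ|})) ?_).trans ((measureReal_union_le _ _).trans
      ((add_le_add hwindow (measureReal_union_le _ _)).trans (by linarith)))
  intro ω hω
  rw [Set.mem_ofPred_eq, abs_div, abs_of_nonneg (Real.sqrt_nonneg t),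
    le_div_iff₀ (Real.sqrt_pos.2 ht)] at hω
  by_contra! hnot
  simp only [Set.mem_union, Set.mem_ofPred_eq, not_or, not_le] at hnot
  exact hnot.1 ⟨_, _, hnot.2.1, hnot.2.2, hω⟩

section IndexInversion

variable [IsFiniteMeasure P] {T : ℕ → Ω → ℝ} {c : ℝ} {m : ℝ → ℕ} {u : ℝ}

theorem tendsto_atTop_of_tendsto_div (hu : 0 < u)
    (hm : Tendsto (fun t => (m t : ℝ) / t) atTop (𝓝 u)) : Tendsto m atTop atTop := by
  refine tendsto_natCast_atTop_iff.1 ((hm.pos_mul_atTop hu tendsto_id).congr' ?_)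
  filter_upwards [eventually_ne_atTop 0] with t ht
  exact div_mul_cancel₀ _ ht

theorem tendsto_div_natCast_inv (hu : 0 < u)
    (hm : Tendsto (fun t => (m t : ℝ) / t) atTop (𝓝 u)) :
    Tendsto (fun t => t / (m t : ℝ)) atTop (𝓝 u⁻¹) := by
  simpa only [inv_div] using hm.inv₀ hu.ne'

theorem tendsto_measureReal_apply_le (hu : 0 < u)
    (hm : Tendsto (fun t => (m t : ℝ) / t) atTop (𝓝 u)) (huc : u⁻¹ < c)
    (hT : TendstoInMeasure P (fun k ω => T k ω / k) atTop fun _ => c) :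
    Tendsto (fun t => P.real {ω | T (m t) ω ≤ t}) atTop (𝓝 0) := by
  have hTm := hT.comp (tendsto_atTop_of_tendsto_div hu hm)
  refine squeeze_zero (fun _ => measureReal_nonneg) (fun t => measureReal_mono ?_)
    (tendsto_measureReal_le_of_lt hTm (tendsto_div_natCast_inv hu hm) huc)
  exact fun ω (hω : T (m t) ω ≤ t) => div_le_div_of_nonneg_right hω (Nat.cast_nonneg (m t))

theorem tendsto_measureReal_le_apply (hu : 0 < u)
    (hm : Tendsto (fun t => (m t : ℝ) / t) atTop (𝓝 u)) (huc : c < u⁻¹)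
    (hT : TendstoInMeasure P (fun k ω => T k ω / k) atTop fun _ => c) :
    Tendsto (fun t => P.real {ω | t ≤ T (m t) ω}) atTop (𝓝 0) := by
  have hTm := hT.comp (tendsto_atTop_of_tendsto_div hu hm)
  refine squeeze_zero (fun _ => measureReal_nonneg) (fun t => measureReal_mono ?_)
    (tendsto_measureReal_ge_of_gt hTm (tendsto_div_natCast_inv hu hm) huc)
  exact fun ω (hω : t ≤ T (m t) ω) => div_le_div_of_nonneg_right hω (Nat.cast_nonneg (m t))

theorem tendstoInMeasure_index_div (hmono : ∀ ω, Monotone fun k => T k ω) (hc : 0 < c)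
    (hT : TendstoInMeasure P (fun k ω => T k ω / k) atTop fun _ => c) {n : ℝ → Ω → ℕ}
    (hn : ∀ t, 0 ≤ t → ∀ᵐ ω ∂P, T (n t ω) ω ≤ t ∧ t < T (n t ω + 1) ω) :
    TendstoInMeasure P (fun t ω => (n t ω : ℝ) / t) atTop fun _ => c⁻¹ := by
  rw [tendstoInMeasure_iff_measureReal_norm]
  intro ε hε
  obtain ⟨l, hl, hlc, hlε⟩ : ∃ l > 0, l < c⁻¹ ∧ c⁻¹ - ε ≤ l :=
    ⟨max (c⁻¹ / 2) (c⁻¹ - ε), lt_max_of_lt_left (by positivity),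
      max_lt (half_lt_self (by positivity)) (by linarith), le_max_right _ _⟩
  have hu : 0 < c⁻¹ + ε := by positivity
  have hupper := tendsto_measureReal_apply_le hu (tendsto_nat_floor_mul_div_atTop hu.le)
    (inv_lt_of_inv_lt₀ hc (by linarith)) hT
  have hlower := tendsto_measureReal_le_apply (m := fun t => ⌊l * t⌋₊ + 1) hl (by
    simpa [add_div] using (tendsto_nat_floor_mul_div_atTop hl.le).add tendsto_inv_atTop_zero)
    (lt_inv_of_lt_inv₀ hl hlc) hT
  have hsum := hupper.add hlower
  rw [add_zero] at hsum
  refine squeeze_zero' (Eventually.of_forall fun _ => measureReal_nonneg) ?_ hsum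
  filter_upwards [eventually_gt_atTop 0] with t ht
  refine (ENNReal.toReal_mono (measure_ne_top _ _) (measure_mono_ae ?_)).trans
    (measureReal_union_le _ _)
  filter_upwards [hn t ht.le] with ω ⟨hle, hlt⟩ (hω : ε ≤ |(n t ω : ℝ) / t - c⁻¹|)
  rcases le_abs.1 hω with habove | hbelow
  · have hn_ge : (c⁻¹ + ε) * t ≤ n t ω := (le_div_iff₀ ht).1 (by linarith)
    exact Or.inl ((hmono ω (Nat.floor_le_of_le hn_ge)).trans hle)
  · have hn_le : (n t ω : ℝ) ≤ l * t := (div_le_iff₀ ht).1 (by linarith)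
    exact Or.inr (hlt.le.trans (hmono ω (Nat.succ_le_succ (Nat.le_floor hn_le))))

end IndexInversion

end RandomIndices

section WeightedSums

variable {Ω α ι : Type*} {mΩ : MeasurableSpace Ω} {P : Measure Ω}

theorem integral_abs_le_sqrt [IsProbabilityMeasure P] {Z : Ω → ℝ} (hZ : MemLp Z 2 P) :
    ∫ ω, |Z ω| ∂P ≤ √(∫ ω, Z ω ^ 2 ∂P) := by
  refine Real.le_sqrt_of_sq_le (sub_nonneg.1 ?_)
  simpa [variance_eq_sub hZ.abs] using variance_nonneg |Z| P

variable {mα : MeasurableSpace α} {κ : Measure α} {X : ι → Ω → α} {f : α → ℝ}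

theorem memLp_comp_of_hasLaw {q : ENNReal} {Y : Ω → α} (hlaw : HasLaw Y κ P) (hf : MemLp f q κ) :
    MemLp (fun ω => f (Y ω)) q P := by
  rw [← hlaw.map_eq] at hf
  exact hf.comp_of_map hlaw.aemeasurable

theorem integrable_comp_of_hasLaw {Y : Ω → α} (hlaw : HasLaw Y κ P) (hf : Integrable f κ) :
    Integrable (fun ω => f (Y ω)) P :=
  memLp_one_iff_integrable.1 (memLp_comp_of_hasLaw hlaw (memLp_one_iff_integrable.2 hf))

theorem variance_comp_of_hasLaw {Y : Ω → α} (hlaw : HasLaw Y κ P) (hf : AEMeasurable f κ) :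
    Var[fun ω => f (Y ω); P] = Var[f; κ] := by
  rw [← hlaw.map_eq] at hf ⊢
  exact (variance_map hf hlaw.aemeasurable).symm

theorem integral_abs_weighted_sum_le (hlaw : ∀ i, HasLaw (X i) κ P) (hf : Integrable f κ)
    (s : Finset ι) {w : ι → ℝ} (hw : ∀ i, 0 ≤ w i) :
    ∫ ω, |∑ i ∈ s, w i * f (X i ω)| ∂P ≤ (∑ i ∈ s, w i) * ∫ a, |f a| ∂κ := by
  have hint (i : ι) : Integrable (fun ω => w i * f (X i ω)) P :=
    (integrable_comp_of_hasLaw (hlaw i) hf).const_mul _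
  calc ∫ ω, |∑ i ∈ s, w i * f (X i ω)| ∂P
      ≤ ∫ ω, ∑ i ∈ s, |w i * f (X i ω)| ∂P :=
        integral_mono (integrable_finsetSum s fun i _ => hint i).abs
          (integrable_finsetSum s fun i _ => (hint i).abs) fun _ => Finset.abs_sum_le_sum_abs _ _
    _ = ∑ i ∈ s, w i * ∫ ω, |f (X i ω)| ∂P := by
        simp_rw [integral_finsetSum s fun i _ => (hint i).abs, abs_mul, abs_of_nonneg (hw _),
          integral_const_mul]
    _ = (∑ i ∈ s, w i) * ∫ a, |f a| ∂κ := by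
        rw [Finset.sum_mul]
        exact Finset.sum_congr rfl fun i _ => congrArg _ ((hlaw i).integral_comp hf.abs.1)

theorem exists_memLp_two_integral_abs_sub_le [IsFiniteMeasure κ]
    (hf : Integrable f κ) {ε : ℝ} (hε : 0 < ε) :
    ∃ g : α → ℝ, Measurable g ∧ MemLp g 2 κ ∧ ∫ a, |f a - g a| ∂κ ≤ ε := by
  obtain ⟨g, hg, -⟩ := (memLp_one_iff_integrable.2 hf).exists_simpleFunc_eLpNorm_sub_lt
    ENNReal.one_ne_top (ENNReal.ofReal_pos.2 hε).ne'
  refine ⟨g, g.measurable, g.memLp_of_isFiniteMeasure 2 κ, ?_⟩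
  have hmeas : AEStronglyMeasurable (f - ⇑g) κ := hf.1.sub g.aestronglyMeasurable
  calc ∫ a, |f a - g a| ∂κ = (eLpNorm (f - ⇑g) 1 κ).toReal := by
        rw [eLpNorm_one_eq_lintegral_enorm, ← integral_norm_eq_lintegral_enorm hmeas]
        rfl
    _ ≤ ε := ENNReal.toReal_le_of_le_ofReal hε.le hg.le

theorem integral_abs_sub_integral_le [IsProbabilityMeasure κ] (hf : Integrable f κ) :
    ∫ a, |f a - κ[f]| ∂κ ≤ 2 * ∫ a, |f a| ∂κ :=
  calc ∫ a, |f a - κ[f]| ∂κ ≤ ∫ a, (|f a| + |κ[f]|) ∂κ :=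
        integral_mono (hf.sub (integrable_const _)).abs (hf.abs.add (integrable_const _))
          fun a => abs_sub _ _
    _ = ∫ a, |f a| ∂κ + |κ[f]| := by
        rw [integral_add hf.abs (integrable_const _), integral_const, probReal_univ, one_smul]
    _ ≤ 2 * ∫ a, |f a| ∂κ := by linarith [abs_integral_le_integral_abs (f := f) (μ := κ)]

variable [IsProbabilityMeasure P] [IsProbabilityMeasure κ]

theorem integral_sq_weighted_sum_sub (hlaw : ∀ i, HasLaw (X i) κ P)
    (hind : Pairwise fun i j => X i ⟂ᵢ[P] X j) (hf : Measurable f) (hf2 : MemLp f 2 κ)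
    (s : Finset ι) (w : ι → ℝ) :
    ∫ ω, (∑ i ∈ s, w i * (f (X i ω) - κ[f])) ^ 2 ∂P = (∑ i ∈ s, w i ^ 2) * Var[f; κ] := by
  have hL2 (i : ι) : MemLp (fun ω => f (X i ω) - κ[f]) 2 P :=
    (memLp_comp_of_hasLaw (hlaw i) hf2).sub (memLp_const _)
  have hcentered (i : ι) : ∫ ω, (f (X i ω) - κ[f]) ∂P = 0 := by
    rw [integral_sub (integrable_comp_of_hasLaw (hlaw i) (hf2.integrable one_le_two))
      (integrable_const _), integral_const, probReal_univ, one_smul]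
    exact sub_eq_zero.2 ((hlaw i).integral_comp hf2.1)
  have hvar (i : ι) : Var[fun ω => w i * (f (X i ω) - κ[f]); P] = w i ^ 2 * Var[f; κ] := by
    rw [variance_const_mul, variance_sub_const (memLp_comp_of_hasLaw (hlaw i) hf2).1,
      variance_comp_of_hasLaw (hlaw i) hf.aemeasurable]
  have hmeas (i : ι) : Measurable fun a => w i * (f a - κ[f]) := (hf.sub_const _).const_mul _
  have hpairwise : Pairwise fun i j =>
      (fun ω => w i * (f (X i ω) - κ[f])) ⟂ᵢ[P] fun ω => w j * (f (X j ω) - κ[f]) :=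
    fun i j hij => (hind hij).comp (hmeas i) (hmeas j)
  rw [integral_sq_sum (fun i => (hL2 i).const_mul (w i)) hpairwise
    fun i => by rw [integral_const_mul, hcentered, mul_zero], Finset.sum_mul]
  exact Finset.sum_congr rfl fun i _ => hvar i

theorem integral_abs_weighted_sum_sub_le_sqrt (hlaw : ∀ i, HasLaw (X i) κ P)
    (hind : Pairwise fun i j => X i ⟂ᵢ[P] X j) (hf : Measurable f) (hf2 : MemLp f 2 κ)
    (s : Finset ι) (w : ι → ℝ) :
    ∫ ω, |∑ i ∈ s, w i * (f (X i ω) - κ[f])| ∂P ≤ √(Var[f; κ]) * √(∑ i ∈ s, w i ^ 2) := by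
  have hLp : MemLp (fun ω => ∑ i ∈ s, w i * (f (X i ω) - κ[f])) 2 P :=
    memLp_finsetSum s fun i _ =>
      ((memLp_comp_of_hasLaw (hlaw i) hf2).sub (memLp_const _)).const_mul _
  rw [mul_comm, ← Real.sqrt_mul (Finset.sum_nonneg fun i _ => sq_nonneg _),
    ← integral_sq_weighted_sum_sub hlaw hind hf hf2]
  exact integral_abs_le_sqrt hLp

theorem exists_integral_abs_weighted_sum_sub_le (hlaw : ∀ i, HasLaw (X i) κ P)
    (hind : Pairwise fun i j => X i ⟂ᵢ[P] X j) (hf : Integrable f κ) {ε : ℝ} (hε : 0 < ε) :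
    ∃ C : ℝ, ∀ (s : Finset ι) (w : ι → ℝ), (∀ i, 0 ≤ w i) →
      ∫ ω, |∑ i ∈ s, w i * (f (X i ω) - κ[f])| ∂P ≤
        ε * ∑ i ∈ s, w i + C * √(∑ i ∈ s, w i ^ 2) := by
  obtain ⟨g, hg, hg2, hfg⟩ := exists_memLp_two_integral_abs_sub_le hf (half_pos hε)
  have hgi : Integrable g κ := hg2.integrable one_le_two
  have hfgi : Integrable (fun a => f a - g a) κ := hf.sub hgi
  set r : α → ℝ := fun a => f a - g a - ∫ a, (f a - g a) ∂κ with hr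
  have hri : Integrable r κ := hfgi.sub (integrable_const _)
  have hrε : ∫ a, |r a| ∂κ ≤ ε := (integral_abs_sub_integral_le hfgi).trans (by linarith)
  refine ⟨√(Var[g; κ]), fun s w hw => ?_⟩
  have hsplit (ω : Ω) : ∑ i ∈ s, w i * (f (X i ω) - κ[f]) =
      ∑ i ∈ s, w i * r (X i ω) + ∑ i ∈ s, w i * (g (X i ω) - κ[g]) := by
    rw [← Finset.sum_add_distrib]
    exact Finset.sum_congr rfl fun i _ => by simp only [hr, integral_sub hf hgi]; ring
  have hr_sum : Integrable (fun ω => ∑ i ∈ s, w i * r (X i ω)) P :=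
    integrable_finsetSum s fun i _ => (integrable_comp_of_hasLaw (hlaw i) hri).const_mul _
  have hg_sum : Integrable (fun ω => ∑ i ∈ s, w i * (g (X i ω) - κ[g])) P :=
    integrable_finsetSum s fun i _ =>
      ((integrable_comp_of_hasLaw (hlaw i) hgi).sub (integrable_const _)).const_mul _
  calc ∫ ω, |∑ i ∈ s, w i * (f (X i ω) - κ[f])| ∂P
      ≤ ∫ ω, (|∑ i ∈ s, w i * r (X i ω)| + |∑ i ∈ s, w i * (g (X i ω) - κ[g])|) ∂P := by
        simp_rw [hsplit]
        exact integral_mono (hr_sum.add hg_sum).abs (hr_sum.abs.add hg_sum.abs)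
          fun ω => abs_add_le _ _
    _ = ∫ ω, |∑ i ∈ s, w i * r (X i ω)| ∂P + ∫ ω, |∑ i ∈ s, w i * (g (X i ω) - κ[g])| ∂P :=
        integral_add hr_sum.abs hg_sum.abs
    _ ≤ (∑ i ∈ s, w i) * ε + √(Var[g; κ]) * √(∑ i ∈ s, w i ^ 2) := by
        refine add_le_add ((integral_abs_weighted_sum_le hlaw hri s hw).trans ?_)
          (integral_abs_weighted_sum_sub_le_sqrt hlaw hind hg hg2 s w)
        exact mul_le_mul_of_nonneg_left hrε (Finset.sum_nonneg fun i _ => hw i)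
    _ = ε * ∑ i ∈ s, w i + √(Var[g; κ]) * √(∑ i ∈ s, w i ^ 2) := by rw [mul_comm ε]

end WeightedSums

section ConvergenceInDistribution

theorem tendstoInDistribution_comp_tendsto {ι ι' Ω Ω' E : Type*} [MeasurableSpace Ω]
    [MeasurableSpace Ω'] {P : Measure Ω} [IsProbabilityMeasure P] {P' : Measure Ω'}
    [IsProbabilityMeasure P'] [TopologicalSpace E] [MeasurableSpace E] [OpensMeasurableSpace E]
    {l : Filter ι} {l' : Filter ι'} {X : ι → Ω → E} {Z : Ω' → E}
    (h : TendstoInDistribution X l Z (fun _ => P) P') {u : ι' → ι} (hu : Tendsto u l' l) :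
    TendstoInDistribution (fun i => X (u i)) l' Z (fun _ => P) P' :=
  ⟨fun i => h.forall_aemeasurable (u i), h.aemeasurable_limit, h.tendsto.comp hu⟩

theorem tendstoInDistribution_congr_identDistrib {ι Ω₁ Ω₂ Ω' E : Type*}
    {mΩ₁ : MeasurableSpace Ω₁} {mΩ₂ : MeasurableSpace Ω₂} {mΩ' : MeasurableSpace Ω'}
    {P : Measure Ω₁} [IsProbabilityMeasure P] {Q : Measure Ω₂} [IsProbabilityMeasure Q]
    {P' : Measure Ω'} [IsProbabilityMeasure P'] [TopologicalSpace E] [MeasurableSpace E]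
    [OpensMeasurableSpace E] {l : Filter ι} {X : ι → Ω₁ → E} {Y : ι → Ω₂ → E} {Z : Ω' → E}
    (h : TendstoInDistribution X l Z (fun _ => P) P')
    (hXY : ∀ i, IdentDistrib (X i) (Y i) P Q) :
    TendstoInDistribution Y l Z (fun _ => Q) P' := by
  refine ⟨fun i => (hXY i).aemeasurable_snd, h.aemeasurable_limit, ?_⟩
  simpa only [(hXY _).map_eq] using h.tendsto

theorem hasLaw_gaussianReal_zero_div {Ω : Type*} {mΩ : MeasurableSpace Ω} {P : Measure Ω}
    {Y : Ω → ℝ} {a v : ℝ} (ha : a ≠ 0)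
    (hY : HasLaw Y (gaussianReal 0 (a ^ 2 * v).toNNReal) P) :
    HasLaw (fun ω => Y ω / a) (gaussianReal 0 v.toNNReal) P := by
  convert gaussianReal_div_const hY a using 2
  · simp
  · have ha2 : NNReal.mk (a ^ 2) (sq_nonneg a) = (a ^ 2).toNNReal :=
      (Real.toNNReal_of_nonneg (sq_nonneg a)).symm
    rw [ha2, Real.toNNReal_mul (sq_nonneg a), mul_div_cancel_left₀ _ (by simpa using ha)]

theorem tendsto_sqrt_floor_mul_div_sqrt {θ : ℝ} (hθ : 0 ≤ θ) :
    Tendsto (fun t : ℝ => √(⌊θ * t⌋₊ : ℝ) / √t) atTop (𝓝 √θ) := by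
  simpa only [Real.sqrt_div (Nat.cast_nonneg _)] using (tendsto_nat_floor_mul_div_atTop hθ).sqrt

end ConvergenceInDistribution

section IntegerWalk

variable {Ω : Type*} {mΩ : MeasurableSpace Ω} {P : Measure Ω} {κ : Measure ℤ} {ξ : ℕ → Ω → ℤ}

theorem cast_walkOfIncrements (x : ℕ → ℤ) (n : ℕ) :
    (walkOfIncrements x n : ℝ) = ∑ i ∈ Finset.range n, (x i : ℝ) := by
  simp [walkOfIncrements]

theorem walkOfIncrements_succ (x : ℕ → ℤ) (n : ℕ) :
    walkOfIncrements x (n + 1) = walkOfIncrements x n + x n := by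
  simp [walkOfIncrements, Finset.sum_range_succ]

theorem walkOfIncrements_add (x : ℕ → ℤ) (k n : ℕ) :
    walkOfIncrements x (k + n) =
      walkOfIncrements x k + walkOfIncrements (fun i => x (k + i)) n := by
  simp [walkOfIncrements, Finset.sum_range_add]

theorem memLp_walkOfIncrements (hξ : ∀ i, HasLaw (ξ i) κ P)
    (hL2 : MemLp (fun k : ℤ => (k : ℝ)) 2 κ) (n : ℕ) :
    MemLp (fun ω => (walkOfIncrements (fun i => ξ i ω) n : ℝ)) 2 P := by
  simp_rw [cast_walkOfIncrements]
  exact memLp_finsetSum _ fun i _ => memLp_comp_of_hasLaw (hξ i) hL2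

variable [IsProbabilityMeasure P]

theorem integral_sq_walkOfIncrements (hξ : ∀ i, HasLaw (ξ i) κ P) (hind : iIndepFun ξ P)
    (hL2 : MemLp (fun k : ℤ => (k : ℝ)) 2 κ) (h0 : ∫ k : ℤ, (k : ℝ) ∂κ = 0) (n : ℕ) :
    ∫ ω, (walkOfIncrements (fun i => ξ i ω) n : ℝ) ^ 2 ∂P =
      n * Var[fun k : ℤ => (k : ℝ); κ] := by
  simp_rw [cast_walkOfIncrements]
  rw [integral_sq_sum (X := fun i ω => (ξ i ω : ℝ)) (fun i => memLp_comp_of_hasLaw (hξ i) hL2)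
    (fun i j hij => (hind.indepFun hij).comp (measurable_from_top (f := fun k : ℤ => (k : ℝ)))
      (measurable_from_top (f := fun k : ℤ => (k : ℝ))))
    fun i => ((hξ i).integral_comp hL2.1).trans h0]
  simp [variance_comp_of_hasLaw (hξ _) hL2.1.aemeasurable]

variable {Ω' : Type*} {mΩ' : MeasurableSpace Ω'} {P' : Measure Ω'} [IsProbabilityMeasure P']
  {Y : Ω' → ℝ}

theorem tendstoInDistribution_walkOfIncrements (hξ : ∀ i, HasLaw (ξ i) κ P)
    (hind : iIndepFun ξ P) (hL2 : MemLp (fun k : ℤ => (k : ℝ)) 2 κ)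
    (h0 : ∫ k : ℤ, (k : ℝ) ∂κ = 0)
    (hY : HasLaw Y (gaussianReal 0 Var[fun k : ℤ => (k : ℝ); κ].toNNReal) P') :
    TendstoInDistribution
      (fun (n : ℕ) ω => (√(n : ℝ))⁻¹ * (walkOfIncrements (fun i => ξ i ω) n : ℝ)) atTop
      Y (fun _ => P) P' := by
  have hcast : Measurable fun k : ℤ => (k : ℝ) := measurable_from_top
  have hvar : Var[fun ω => (ξ 0 ω : ℝ); P] = Var[fun k : ℤ => (k : ℝ); κ] :=
    variance_comp_of_hasLaw (hξ 0) hcast.aemeasurable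
  have hmean : ∫ ω, (ξ 0 ω : ℝ) ∂P = 0 := ((hξ 0).integral_comp hL2.1).trans h0
  have hclt := tendstoInDistribution_inv_sqrt_mul_sum_sub
    (X := fun i ω => (ξ i ω : ℝ)) (by rwa [hvar]) (memLp_comp_of_hasLaw (hξ 0) hL2)
    (hind.comp (fun _ k => (k : ℝ)) fun _ => hcast)
    fun i => ((hξ i).identDistrib (hξ 0)).comp hcast
  simpa only [cast_walkOfIncrements, hmean, mul_zero, sub_zero] using hclt

theorem tendstoInDistribution_walkOfIncrements_floor_div_sqrt (hξ : ∀ i, HasLaw (ξ i) κ P)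
    (hind : iIndepFun ξ P) (hL2 : MemLp (fun k : ℤ => (k : ℝ)) 2 κ)
    (h0 : ∫ k : ℤ, (k : ℝ) ∂κ = 0) {θ : ℝ} (hθ : 0 < θ)
    (hY : HasLaw Y (gaussianReal 0 (θ * Var[fun k : ℤ => (k : ℝ); κ]).toNNReal) P') :
    TendstoInDistribution
      (fun (t : ℝ) ω => (walkOfIncrements (fun i => ξ i ω) ⌊θ * t⌋₊ : ℝ) / √t) atTop
      Y (fun _ => P) P' := by
  have hsqrt : √θ ≠ 0 := (Real.sqrt_pos.2 hθ).ne'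
  have hY' : HasLaw (fun ω => Y ω / √θ)
      (gaussianReal 0 Var[fun k : ℤ => (k : ℝ); κ].toNNReal) P' :=
    hasLaw_gaussianReal_zero_div hsqrt (by rwa [Real.sq_sqrt hθ.le])
  have hfloor : Tendsto (fun t : ℝ => ⌊θ * t⌋₊) atTop atTop :=
    tendsto_nat_floor_atTop.comp (tendsto_id.const_mul_atTop hθ)
  have hclt := tendstoInDistribution_comp_tendsto
    (tendstoInDistribution_walkOfIncrements hξ hind hL2 h0 hY') hfloor
  have hscale : TendstoInMeasure P (fun (t : ℝ) _ => √(⌊θ * t⌋₊ : ℝ) / √t) atTop fun _ => √θ :=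
    tendstoInMeasure_of_ae_tendsto (fun _ => aestronglyMeasurable_const)
      (ae_of_all _ fun _ => tendsto_sqrt_floor_mul_div_sqrt hθ.le)
  have hprod := hclt.continuous_comp_prodMk_of_tendstoInMeasure_const
    (g := fun q : ℝ × ℝ => q.1 * q.2) continuous_mul hscale fun _ => aemeasurable_const
  refine hprod.congr (fun t => ae_of_all _ fun ω => ?_)
    (ae_of_all _ fun ω => div_mul_cancel₀ _ hsqrt)
  rcases eq_or_ne ⌊θ * t⌋₊ 0 with hzero | hne
  · simp [hzero, walkOfIncrements]
  · have : √(⌊θ * t⌋₊ : ℝ) ≠ 0 := (Real.sqrt_pos.2 (by positivity)).ne'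
    field_simp

end IntegerWalk

section StepDistribution

variable {p : PMF ℤ}

theorem integrable_toMeasure_of_summable {f : ℤ → ℝ}
    (hf : Summable fun k => |f k| * (p k).toReal) : Integrable f p.toMeasure := by
  refine ⟨by fun_prop, ?_⟩
  have hterm (k : ℤ) : ‖f k‖ₑ * p.toMeasure {k} = ENNReal.ofReal (|f k| * (p k).toReal) := by
    rw [p.toMeasure_apply_singleton k (measurableSet_singleton k),
      ENNReal.ofReal_mul (abs_nonneg _), ENNReal.ofReal_toReal (p.apply_ne_top k),
      Real.enorm_eq_ofReal_abs]
  simp_rw [HasFiniteIntegral, lintegral_countable', hterm]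
  rw [← ENNReal.ofReal_tsum_of_nonneg (fun k => by positivity) hf]
  exact ENNReal.ofReal_lt_top

theorem integral_toMeasure {f : ℤ → ℝ} (hf : Integrable f p.toMeasure) :
    ∫ k, f k ∂p.toMeasure = ∑' k, f k * (p k).toReal := by
  simp_rw [PMF.integral_eq_tsum p f hf, smul_eq_mul, mul_comm]

theorem memLp_two_step (hv : Summable fun k : ℤ => (k : ℝ) ^ 2 * (p k).toReal) :
    MemLp (fun k : ℤ => (k : ℝ)) 2 p.toMeasure :=
  (memLp_two_iff_integrable_sq (by fun_prop)).2
    (integrable_toMeasure_of_summable (by simpa only [abs_sq] using hv))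

theorem variance_step (hL2 : MemLp (fun k : ℤ => (k : ℝ)) 2 p.toMeasure)
    (h0 : ∫ k : ℤ, (k : ℝ) ∂p.toMeasure = 0) :
    Var[fun k : ℤ => (k : ℝ); p.toMeasure] = ∑' k : ℤ, (k : ℝ) ^ 2 * (p k).toReal := by
  rw [variance_of_integral_eq_zero (by fun_prop) h0, integral_toMeasure hL2.integrable_sq]

theorem tsum_mul_eq_zero_of_symm (hsymm : ∀ k : ℤ, p (-k) = p k) :
    ∑' k : ℤ, (k : ℝ) * (p k).toReal = 0 := by
  have hneg := (Equiv.neg ℤ).tsum_eq fun k : ℤ => (k : ℝ) * (p k).toReal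
  simp only [Equiv.neg_apply, hsymm, Int.cast_neg, neg_mul, tsum_neg] at hneg
  linarith

theorem integral_abs_step (hL2 : MemLp (fun k : ℤ => (k : ℝ)) 2 p.toMeasure) :
    ∫ k : ℤ, |(k : ℝ)| ∂p.toMeasure = meanAbsJump p :=
  integral_toMeasure (hL2.integrable one_le_two).abs

theorem meanAbsJump_pos (hL2 : MemLp (fun k : ℤ => (k : ℝ)) 2 p.toMeasure)
    (hvar : 0 < Var[fun k : ℤ => (k : ℝ); p.toMeasure]) : 0 < meanAbsJump p := by
  have hint : Integrable (fun k : ℤ => |(k : ℝ)|) p.toMeasure := (hL2.integrable one_le_two).abs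
  rw [← integral_abs_step hL2]
  refine (integral_nonneg fun k => abs_nonneg _).lt_of_ne' fun hzero => hvar.ne' ?_
  have hae := (integral_eq_zero_iff_of_nonneg (fun k => abs_nonneg _) hint).1 hzero
  have hstep : (fun k : ℤ => (k : ℝ)) =ᵐ[p.toMeasure] 0 := hae.mono fun k hk => abs_eq_zero.1 hk
  rw [variance_congr hstep, variance_zero]

end StepDistribution

section CoordinateLaws

variable {ι α : Type*} {mα : MeasurableSpace α} {κ : Measure α} [IsProbabilityMeasure κ]

theorem hasLaw_eval_infinitePi (i : ι) :
    HasLaw (fun x : ι → α => x i) κ (Measure.infinitePi fun _ : ι => κ) :=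
  (measurePreserving_eval_infinitePi (fun _ : ι => κ) i).hasLaw

theorem iIndepFun_eval_infinitePi :
    iIndepFun (fun i (x : ι → α) => x i) (Measure.infinitePi fun _ : ι => κ) :=
  iIndepFun_infinitePi (X := fun _ a => a) fun _ => measurable_id

theorem measurePreserving_shift (k : ℕ) :
    MeasurePreserving (fun (x : ℕ → α) i => x (k + i)) (Measure.infinitePi fun _ : ℕ => κ)
      (Measure.infinitePi fun _ : ℕ => κ) where
  measurable := by fun_prop
  map_eq := Measure.map_infinitePi_infinitePi_of_inj (P := fun _ => κ) (add_right_injective k)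

end CoordinateLaws

section WalkLaw

variable {p : PMF ℤ}

/-- The law of the i.i.d. increments `ξ₁, ξ₂, …` of the walk, indexed from `0`. -/
noncomputable abbrev stepLaw (p : PMF ℤ) : Measure (ℕ → ℤ) :=
  Measure.infinitePi fun _ : ℕ => p.toMeasure

theorem normalizedMoment_two (hL2 : MemLp (fun k : ℤ => (k : ℝ)) 2 p.toMeasure)
    (h0 : ∫ k : ℤ, (k : ℝ) ∂p.toMeasure = 0) {n : ℕ} (hn : n ≠ 0) :
    normalizedMoment p 2 n = Var[fun k : ℤ => (k : ℝ); p.toMeasure] := by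
  have hmeas : Measurable fun S : ℕ → ℤ => |(S n : ℝ)| ^ (2 : ℝ) :=
    (measurable_from_top (f := fun k : ℤ => |(k : ℝ)| ^ (2 : ℝ))).comp (measurable_pi_apply n)
  have hmoment := integral_sq_walkOfIncrements (P := stepLaw p) hasLaw_eval_infinitePi
    iIndepFun_eval_infinitePi hL2 h0 n
  rw [normalizedMoment, walkLaw, integral_map measurable_walkOfIncrements.aemeasurable
    hmeas.aestronglyMeasurable, div_self two_ne_zero, Real.rpow_one]
  simp_rw [Real.rpow_two, sq_abs, hmoment]
  field_simp

theorem tendsto_normalizedMoment_two (hL2 : MemLp (fun k : ℤ => (k : ℝ)) 2 p.toMeasure)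
    (h0 : ∫ k : ℤ, (k : ℝ) ∂p.toMeasure = 0) :
    Tendsto (normalizedMoment p 2) atTop (𝓝 Var[fun k : ℤ => (k : ℝ); p.toMeasure]) :=
  tendsto_const_nhds.congr' ((eventually_ne_atTop 0).mono fun _ hn =>
    (normalizedMoment_two hL2 h0 hn).symm)

theorem rescaledMoment_two (hL2 : MemLp (fun k : ℤ => (k : ℝ)) 2 p.toMeasure)
    (h0 : ∫ k : ℤ, (k : ℝ) ∂p.toMeasure = 0) :
    rescaledMoment p 2 = Var[fun k : ℤ => (k : ℝ); p.toMeasure] :=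
  (tendsto_normalizedMoment_two hL2 h0).limUnder_eq

end WalkLaw

section LimitInDistribution

variable {ι Ω Ω' : Type*} {mΩ : MeasurableSpace Ω} {mΩ' : MeasurableSpace Ω'} {P : Measure Ω}
  [IsProbabilityMeasure P] {P' : Measure Ω'} [IsProbabilityMeasure P'] {l : Filter ι}
  {X R : ι → Ω → ℝ} {Z : Ω' → ℝ}

theorem exists_eventually_measureReal_abs_le_of_tendstoInDistribution [l.IsCountablyGenerated]
    (hX : TendstoInDistribution X l Z (fun _ => P) P') (hZ : NullSingletonClass (P'.map Z))
    {η : ℝ} (hη : 0 < η) : ∃ δ > 0, ∀ᶠ i in l, P.real {ω | |X i ω| ≤ δ} ≤ η := by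
  have hshrink : Tendsto (fun δ : ℝ => P'.map Z (Set.Icc (0 - δ) (0 + δ))) (𝓝[>] 0) (𝓝 0) :=
    (tendsto_measure_Icc (P'.map Z) 0).mono_left nhdsWithin_le_nhds
  obtain ⟨δ, hδη, hδ⟩ := ((hshrink.eventually_lt_const (ENNReal.ofReal_pos.2 hη)).and
    self_mem_nhdsWithin).exists
  refine ⟨δ, hδ, ?_⟩
  have hlimsup := ProbabilityMeasure.limsup_measure_closed_le_of_tendsto hX.tendsto
    (isClosed_Icc (a := 0 - δ) (b := 0 + δ))
  filter_upwards [eventually_lt_of_limsup_lt (hlimsup.trans_lt hδη)] with i hi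
  have hIcc : {ω | |X i ω| ≤ δ} = X i ⁻¹' Set.Icc (0 - δ) (0 + δ) := by
    ext ω
    simp [abs_le]
  rw [ProbabilityMeasure.coe_mk,
    Measure.map_apply_of_aemeasurable (hX.forall_aemeasurable i) measurableSet_Icc, ← hIcc] at hi
  exact ENNReal.toReal_le_of_le_ofReal hη.le hi.le

theorem tendsto_measureReal_abs_le_of_tendstoInDistribution [l.IsCountablyGenerated]
    (hX : TendstoInDistribution X l Z (fun _ => P) P') (hZ : NullSingletonClass (P'.map Z))
    (hR : TendstoInMeasure P R l fun _ => 0) :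
    Tendsto (fun i => P.real {ω | |X i ω| ≤ R i ω}) l (𝓝 0) := by
  refine tendsto_zero_of_forall_eventually_le_add (fun i => measureReal_nonneg) fun η hη => ?_
  obtain ⟨δ, hδ, hXδ⟩ :=
    exists_eventually_measureReal_abs_le_of_tendstoInDistribution hX hZ hη
  refine ⟨fun i => P.real {ω | δ ≤ R i ω},
    tendsto_measureReal_ge_of_gt hR tendsto_const_nhds hδ, hXδ.mono fun i hi => ?_⟩
  calc P.real {ω | |X i ω| ≤ R i ω}
      ≤ P.real ({ω | |X i ω| ≤ δ} ∪ {ω | δ ≤ R i ω}) :=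
        measureReal_mono fun ω hω => (le_total (R i ω) δ).imp (le_trans hω) id
    _ ≤ P.real {ω | |X i ω| ≤ δ} + P.real {ω | δ ≤ R i ω} := measureReal_union_le _ _
    _ ≤ η + P.real {ω | δ ≤ R i ω} := by gcongr

end LimitInDistribution

section CoverCount

variable {ι α : Type*} [DecidableEq α] (s : Finset ι) (J : ι → Finset α)

/-- The number of sets of the finite family `(J k)_{k ∈ s}` that contain `a`. -/
def coverCount (a : α) : ℕ := (s.filter fun k => a ∈ J k).card

theorem sum_sum_eq_sum_coverCount_mul (g : α → ℝ) :
    ∑ k ∈ s, ∑ a ∈ J k, g a = ∑ a ∈ s.biUnion J, coverCount s J a * g a := by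
  rw [Finset.sum_comm' (t' := s.biUnion J) (s' := fun a => s.filter fun k => a ∈ J k)
    fun k a => by
      simp only [Finset.mem_biUnion, Finset.mem_filter]
      exact ⟨fun h => ⟨h, k, h⟩, And.left⟩]
  simp only [Finset.sum_const, nsmul_eq_mul, coverCount]

theorem sum_coverCount :
    ∑ a ∈ s.biUnion J, (coverCount s J a : ℝ) = ∑ k ∈ s, ((J k).card : ℝ) := by
  simpa using (sum_sum_eq_sum_coverCount_mul s J fun _ => 1).symm

theorem sum_sq_coverCount :
    ∑ a ∈ s.biUnion J, (coverCount s J a : ℝ) ^ 2 =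
      ∑ k ∈ s, ∑ l ∈ s, ((J k ∩ J l).card : ℝ) := by
  have hcard (k : ι) : ∑ a ∈ J k, (coverCount s J a : ℝ) = ∑ l ∈ s, ((J k ∩ J l).card : ℝ) := by
    simp only [coverCount, Finset.card_filter, Nat.cast_sum, Nat.cast_ite, Nat.cast_one,
      Nat.cast_zero]
    rw [Finset.sum_comm]
    exact Finset.sum_congr rfl fun l _ => by simp
  simp_rw [sq, ← sum_sum_eq_sum_coverCount_mul, hcard]

end CoverCount

section JumpEdges

/-- The edges crossed by a jump of `S` from time `k` to time `k + 1`, where the edge between the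
sites `j - 1` and `j` is labelled by `j`, as is the gap `ζ j` between the corresponding targets. -/
noncomputable def jumpEdges (S : ℕ → ℤ) (k : ℕ) : Finset ℤ :=
  Finset.Ioc (min (S k) (S (k + 1))) (max (S k) (S (k + 1)))

theorem card_jumpEdges (S : ℕ → ℤ) (k : ℕ) :
    ((jumpEdges S k).card : ℝ) = |(S (k + 1) : ℝ) - S k| := by
  have hcard : ((jumpEdges S k).card : ℤ) = |S (k + 1) - S k| := by
    rw [jumpEdges, Int.card_Ioc, Int.toNat_of_nonneg (by simp), max_sub_min_eq_abs]
  exact_mod_cast hcard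

theorem card_jumpEdges_walkOfIncrements (x : ℕ → ℤ) (k : ℕ) :
    ((jumpEdges (walkOfIncrements x) k).card : ℝ) = |(x k : ℝ)| := by
  rw [card_jumpEdges, walkOfIncrements_succ, Int.cast_add, add_sub_cancel_left]

theorem abs_sub_le_of_mem_jumpEdges {S : ℕ → ℤ} {k : ℕ} {j : ℤ} (hj : j ∈ jumpEdges S k) :
    |j - S k| ≤ |S (k + 1) - S k| := by
  simp only [jumpEdges, Finset.mem_Ioc] at hj
  grind

theorem abs_sub_le_of_not_disjoint_jumpEdges {S : ℕ → ℤ} {k l : ℕ}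
    (h : ¬Disjoint (jumpEdges S k) (jumpEdges S l)) :
    |S l - S k| ≤ |S (k + 1) - S k| + |S (l + 1) - S l| := by
  obtain ⟨j, hjk, hjl⟩ := Finset.not_disjoint_iff.1 h
  calc |S l - S k| ≤ |S l - j| + |j - S k| := abs_sub_le _ _ _
    _ ≤ |S (k + 1) - S k| + |S (l + 1) - S l| := by
      rw [add_comm, abs_sub_comm (S l)]
      exact add_le_add (abs_sub_le_of_mem_jumpEdges hjk) (abs_sub_le_of_mem_jumpEdges hjl)

theorem target_sub_target (ζ : ℤ → Set.Ioi (0 : ℝ)) {a b : ℤ} (hab : a ≤ b) :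
    target ζ b - target ζ a = ∑ j ∈ Finset.Ioc a b, (ζ j : ℝ) := by
  induction b, hab using Int.leInduction with
  | base => simp
  | succ b hab ih =>
    have hIoc : Finset.Ioc a (b + 1) = insert (b + 1) (Finset.Ioc a b) := by
      ext i
      simp only [Finset.mem_Ioc, Finset.mem_insert]
      lia
    rw [hIoc, Finset.sum_insert (by simp), ← ih, target_eq_add ζ (b + 1), add_sub_cancel_right]
    ring

theorem abs_target_sub (ζ : ℤ → Set.Ioi (0 : ℝ)) (a b : ℤ) :
    |target ζ b - target ζ a| = ∑ j ∈ Finset.Ioc (min a b) (max a b), (ζ j : ℝ) := by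
  have hmono := (target_strictMono ζ).monotone
  rw [← target_sub_target ζ (min_le_max (a := a) (b := b)), hmono.map_max, hmono.map_min,
    max_sub_min_eq_abs]

theorem collisionTime_envOfGaps (S : ℕ → ℤ) (ζ : ℤ → Set.Ioi (0 : ℝ)) (n : ℕ) :
    collisionTime S (envOfGaps ζ) n =
      ∑ k ∈ Finset.range n, ∑ j ∈ jumpEdges S k, (ζ j : ℝ) :=
  Finset.sum_congr rfl fun k _ => abs_target_sub ζ (S k) (S (k + 1))

theorem collisionTime_sub_eq_sum_coverCount (S : ℕ → ℤ) (ζ : ℤ → Set.Ioi (0 : ℝ)) (n : ℕ)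
    (m : ℝ) :
    collisionTime S (envOfGaps ζ) n - m * ∑ k ∈ Finset.range n, ((jumpEdges S k).card : ℝ) =
      ∑ j ∈ (Finset.range n).biUnion (jumpEdges S),
        coverCount (Finset.range n) (jumpEdges S) j * ((ζ j : ℝ) - m) := by
  rw [← sum_sum_eq_sum_coverCount_mul, collisionTime_envOfGaps, Finset.mul_sum,
    ← Finset.sum_sub_distrib]
  exact Finset.sum_congr rfl fun k _ => by simp [mul_comm]

theorem jumpEdges_walkOfIncrements_add (x : ℕ → ℤ) (k m : ℕ) :
    jumpEdges (walkOfIncrements x) (k + m) =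
      (jumpEdges (walkOfIncrements fun i => x (k + i)) m).map
        (addLeftEmbedding (walkOfIncrements x k)) := by
  rw [jumpEdges, add_assoc, walkOfIncrements_add, walkOfIncrements_add, min_add_add_left,
    max_add_add_left, ← Finset.map_add_left_Ioc]
  rfl

end JumpEdges

theorem tendstoInMeasure_zero_of_tendsto_integral_abs {ι Ω : Type*} {mΩ : MeasurableSpace Ω}
    {P : Measure Ω} [IsFiniteMeasure P] {l : Filter ι} {Y : ι → Ω → ℝ}
    (hY : ∀ i, Integrable (Y i) P) (h : Tendsto (fun i => ∫ ω, |Y i ω| ∂P) l (𝓝 0)) :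
    TendstoInMeasure P Y l fun _ => 0 := by
  refine tendstoInMeasure_iff_measureReal_norm.2 fun ε hε => ?_
  have hbound : Tendsto (fun i => (∫ ω, |Y i ω| ∂P) / ε) l (𝓝 0) := by
    simpa using h.div_const ε
  refine squeeze_zero (fun _ => measureReal_nonneg) (fun i => ?_) hbound
  rw [le_div_iff₀' hε]
  simpa using mul_meas_ge_le_integral_of_nonneg (ae_of_all P fun ω => abs_nonneg (Y i ω))
    (hY i).abs ε

theorem sum_sum_dist_le {φ : ℕ → ℝ} (hφ : ∀ m, 0 ≤ φ m) (n : ℕ) :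
    ∑ k ∈ Finset.range n, ∑ l ∈ Finset.range n, φ (k.dist l) ≤
      2 * n * ∑ m ∈ Finset.range n, φ m := by
  have hpartial {k : ℕ} (hk : k ≤ n) : ∑ m ∈ Finset.range k, φ m ≤ ∑ m ∈ Finset.range n, φ m :=
    Finset.sum_le_sum_of_subset_of_nonneg (Finset.range_mono hk) fun m _ _ => hφ m
  have hrow (k : ℕ) (hk : k ∈ Finset.range n) :
      ∑ l ∈ Finset.range n, φ (k.dist l) ≤ 2 * ∑ m ∈ Finset.range n, φ m := by
    have hkn : k + 1 ≤ n := Finset.mem_range.1 hk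
    have hsplit := Finset.sum_range_add (fun l => φ (k.dist l)) k (n - k)
    rw [Nat.add_sub_cancel' (by lia)] at hsplit
    have hbelow : ∑ l ∈ Finset.range k, φ (k.dist l) = ∑ j ∈ Finset.range k, φ (j + 1) := by
      rw [← Finset.sum_range_reflect]
      refine Finset.sum_congr rfl fun j hj => ?_
      have hjk : j < k := Finset.mem_range.1 hj
      rw [Nat.dist_eq_sub_of_le_right (by lia), show k - (k - 1 - j) = j + 1 by lia]
    have habove (j : ℕ) : k.dist (k + j) = j := by
      rw [Nat.dist_eq_sub_of_le (by lia), Nat.add_sub_cancel_left]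
    simp only [hbelow, habove] at hsplit
    have hsucc := Finset.sum_range_succ' φ k
    linarith [hpartial hkn, hpartial (Nat.sub_le n k), hφ 0]
  calc ∑ k ∈ Finset.range n, ∑ l ∈ Finset.range n, φ (k.dist l)
      ≤ ∑ k ∈ Finset.range n, 2 * ∑ m ∈ Finset.range n, φ m := Finset.sum_le_sum hrow
    _ = 2 * n * ∑ m ∈ Finset.range n, φ m := by
      rw [Finset.sum_const, Finset.card_range, nsmul_eq_mul]
      ring

section Overlap

variable {p : PMF ℤ}

theorem measurable_card_jumpEdges_inter (k l : ℕ) :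
    Measurable fun x =>
      ((jumpEdges (walkOfIncrements x) k ∩ jumpEdges (walkOfIncrements x) l).card : ℝ) := by
  have hwalk (n : ℕ) : Measurable fun x => walkOfIncrements x n :=
    (measurable_pi_apply n).comp measurable_walkOfIncrements
  have hcomp (F : (ℤ × ℤ) × ℤ × ℤ → ℝ) : Measurable fun x =>
      F ((walkOfIncrements x k, walkOfIncrements x (k + 1)),
        walkOfIncrements x l, walkOfIncrements x (l + 1)) :=
    (measurable_of_countable F).comp
      (((hwalk k).prodMk (hwalk (k + 1))).prodMk ((hwalk l).prodMk (hwalk (l + 1))))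
  exact hcomp fun q => ((Finset.Ioc (min q.1.1 q.1.2) (max q.1.1 q.1.2) ∩
    Finset.Ioc (min q.2.1 q.2.2) (max q.2.1 q.2.2)).card : ℝ)

theorem card_jumpEdges_inter_le (x : ℕ → ℤ) (k l : ℕ) :
    ((jumpEdges (walkOfIncrements x) k ∩ jumpEdges (walkOfIncrements x) l).card : ℝ) ≤
      |(x k : ℝ)| := by
  rw [← card_jumpEdges_walkOfIncrements]
  exact_mod_cast Finset.card_le_card Finset.inter_subset_left

theorem integrable_card_jumpEdges_inter (hint : Integrable (fun k : ℤ => (k : ℝ)) p.toMeasure)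
    (k l : ℕ) :
    Integrable (fun x => ((jumpEdges (walkOfIncrements x) k ∩
      jumpEdges (walkOfIncrements x) l).card : ℝ)) (stepLaw p) :=
  (integrable_comp_of_hasLaw (hasLaw_eval_infinitePi k) hint.abs).mono'
    (measurable_card_jumpEdges_inter k l).aestronglyMeasurable
    (ae_of_all _ fun x => by simpa using card_jumpEdges_inter_le x k l)

/-- The expected number of edges crossed by both of two jumps of the walk that are `m` steps
apart. -/
noncomputable def meanOverlap (p : PMF ℤ) (m : ℕ) : ℝ :=
  ∫ x, ((jumpEdges (walkOfIncrements x) 0 ∩ jumpEdges (walkOfIncrements x) m).card : ℝ) ∂stepLaw p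

theorem meanOverlap_nonneg (p : PMF ℤ) (m : ℕ) : 0 ≤ meanOverlap p m :=
  integral_nonneg fun _ => Nat.cast_nonneg _

theorem integral_card_jumpEdges_inter_add (p : PMF ℤ) (k m : ℕ) :
    ∫ x, ((jumpEdges (walkOfIncrements x) k ∩ jumpEdges (walkOfIncrements x) (k + m)).card : ℝ)
      ∂stepLaw p = meanOverlap p m := by
  have hshift := measurePreserving_shift (κ := p.toMeasure) k
  have hmap := integral_map hshift.aemeasurable
    (measurable_card_jumpEdges_inter 0 m).aestronglyMeasurable
  rw [hshift.map_eq] at hmap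
  rw [meanOverlap, hmap]
  refine integral_congr_ae (ae_of_all _ fun x => ?_)
  have hk := jumpEdges_walkOfIncrements_add x k 0
  rw [add_zero] at hk
  simp only [hk, jumpEdges_walkOfIncrements_add x k m, ← Finset.map_inter, Finset.card_map]

theorem integral_card_jumpEdges_inter (p : PMF ℤ) (k l : ℕ) :
    ∫ x, ((jumpEdges (walkOfIncrements x) k ∩ jumpEdges (walkOfIncrements x) l).card : ℝ)
      ∂stepLaw p = meanOverlap p (k.dist l) := by
  wlog hkl : k ≤ l generalizing k l
  · simpa only [Finset.inter_comm, Nat.dist_comm] using this l k (le_of_not_ge hkl)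
  · obtain ⟨m, rfl⟩ := Nat.exists_eq_add_of_le hkl
    rw [integral_card_jumpEdges_inter_add, Nat.dist_eq_sub_of_le hkl, Nat.add_sub_cancel_left]

theorem abs_walkOfIncrements_le_of_not_disjoint_jumpEdges {x : ℕ → ℤ} {m : ℕ}
    (h : ¬Disjoint (jumpEdges (walkOfIncrements x) 0) (jumpEdges (walkOfIncrements x) m)) :
    |(walkOfIncrements x m : ℝ)| ≤ |(x 0 : ℝ)| + |(x m : ℝ)| := by
  have hle := abs_sub_le_of_not_disjoint_jumpEdges h
  simp only [walkOfIncrements_succ, add_sub_cancel_left] at hle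
  have hzero : walkOfIncrements x 0 = 0 := by simp [walkOfIncrements]
  rw [hzero, sub_zero] at hle
  exact_mod_cast hle

theorem tendstoInMeasure_inv_sqrt_mul_abs_add_abs
    (hint : Integrable (fun k : ℤ => (k : ℝ)) p.toMeasure) :
    TendstoInMeasure (stepLaw p) (fun (m : ℕ) x => (√(m : ℝ))⁻¹ * (|(x 0 : ℝ)| + |(x m : ℝ)|))
      atTop fun _ => 0 := by
  have habs (i : ℕ) : Integrable (fun x : ℕ → ℤ => |(x i : ℝ)|) (stepLaw p) :=
    integrable_comp_of_hasLaw (f := fun k : ℤ => |(k : ℝ)|) (hasLaw_eval_infinitePi i) hint.abs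
  have hlaw (i : ℕ) : ∫ x : ℕ → ℤ, |(x i : ℝ)| ∂stepLaw p = ∫ k : ℤ, |(k : ℝ)| ∂p.toMeasure :=
    (hasLaw_eval_infinitePi i).integral_comp hint.abs.1
  have hinv : Tendsto (fun m : ℕ => (√(m : ℝ))⁻¹) atTop (𝓝 0) :=
    tendsto_inv_atTop_zero.comp (Real.tendsto_sqrt_atTop.comp tendsto_natCast_atTop_atTop)
  refine tendstoInMeasure_zero_of_tendsto_integral_abs
    (fun m => ((habs 0).add (habs m)).const_mul _) ?_
  have hmean (m : ℕ) : ∫ x : ℕ → ℤ, |(√(m : ℝ))⁻¹ * (|(x 0 : ℝ)| + |(x m : ℝ)|)| ∂stepLaw p =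
      (√(m : ℝ))⁻¹ * (∫ k : ℤ, |(k : ℝ)| ∂p.toMeasure + ∫ k : ℤ, |(k : ℝ)| ∂p.toMeasure) := by
    simp_rw [abs_of_nonneg (mul_nonneg (inv_nonneg.2 (Real.sqrt_nonneg _))
      (add_nonneg (abs_nonneg _) (abs_nonneg _)))]
    rw [integral_const_mul, integral_add (habs 0) (habs m), hlaw, hlaw]
  simpa only [hmean, zero_mul] using hinv.mul_const _

/-- The event that the walk at time `m` is within `|ξ₁| + |ξₘ₊₁|` of its starting point. -/
def nearReturn (m : ℕ) : Set (ℕ → ℤ) :=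
  {x | |(walkOfIncrements x m : ℝ)| ≤ |(x 0 : ℝ)| + |(x m : ℝ)|}

theorem measurableSet_nearReturn (m : ℕ) : MeasurableSet (nearReturn m) := by
  have hcast : Measurable fun k : ℤ => |(k : ℝ)| := measurable_from_top
  exact measurableSet_le (hcast.comp ((measurable_pi_apply m).comp measurable_walkOfIncrements))
    ((hcast.comp (measurable_pi_apply 0)).add (hcast.comp (measurable_pi_apply m)))

theorem tendsto_measureReal_nearReturn (hL2 : MemLp (fun k : ℤ => (k : ℝ)) 2 p.toMeasure)
    (h0 : ∫ k : ℤ, (k : ℝ) ∂p.toMeasure = 0)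
    (hvar : 0 < Var[fun k : ℤ => (k : ℝ); p.toMeasure]) :
    Tendsto (fun m => (stepLaw p).real (nearReturn m)) atTop (𝓝 0) := by
  have hclt := tendstoInDistribution_walkOfIncrements (P := stepLaw p) hasLaw_eval_infinitePi
    iIndepFun_eval_infinitePi hL2 h0 HasLaw.id
  have hatomless : NullSingletonClass
      ((gaussianReal 0 Var[fun k : ℤ => (k : ℝ); p.toMeasure].toNNReal).map (id : ℝ → ℝ)) := by
    rw [Measure.map_id]
    exact nullSingletonClass_gaussianReal (by simpa using hvar)
  refine squeeze_zero (fun _ => measureReal_nonneg)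
    (fun m => measureReal_mono fun x hx => ?_)
    (tendsto_measureReal_abs_le_of_tendstoInDistribution hclt hatomless
      (tendstoInMeasure_inv_sqrt_mul_abs_add_abs (hL2.integrable one_le_two)))
  rw [nearReturn, Set.mem_ofPred_eq] at hx
  rw [Set.mem_ofPred_eq, abs_mul, abs_of_nonneg (inv_nonneg.2 (Real.sqrt_nonneg _))]
  gcongr

theorem tendsto_meanOverlap (hL2 : MemLp (fun k : ℤ => (k : ℝ)) 2 p.toMeasure)
    (h0 : ∫ k : ℤ, (k : ℝ) ∂p.toMeasure = 0)
    (hvar : 0 < Var[fun k : ℤ => (k : ℝ); p.toMeasure]) :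
    Tendsto (meanOverlap p) atTop (𝓝 0) := by
  have hint : Integrable (fun k : ℤ => (k : ℝ)) p.toMeasure := hL2.integrable one_le_two
  have hstep : Integrable (fun x : ℕ → ℤ => |(x 0 : ℝ)|) (stepLaw p) :=
    integrable_comp_of_hasLaw (f := fun k : ℤ => |(k : ℝ)|) (hasLaw_eval_infinitePi 0) hint.abs
  have hnear : Tendsto (stepLaw p ∘ nearReturn) atTop (𝓝 0) :=
    (ENNReal.tendsto_toReal_iff (fun _ => measure_ne_top _ _) ENNReal.zero_ne_top).1
      (tendsto_measureReal_nearReturn hL2 h0 hvar)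
  refine squeeze_zero (meanOverlap_nonneg p) (fun m => ?_)
    (hstep.tendsto_setIntegral_nhds_zero hnear)
  rw [← integral_indicator (measurableSet_nearReturn m)]
  refine integral_mono (integrable_card_jumpEdges_inter hint 0 m)
    (hstep.indicator (measurableSet_nearReturn m)) fun x => ?_
  by_cases hx : Disjoint (jumpEdges (walkOfIncrements x) 0) (jumpEdges (walkOfIncrements x) m)
  · simpa [Finset.disjoint_iff_inter_eq_empty.1 hx] using
      Set.indicator_nonneg (fun _ _ => abs_nonneg _) x
  · have hmem : x ∈ nearReturn m := abs_walkOfIncrements_le_of_not_disjoint_jumpEdges hx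
    simpa only [Set.indicator_of_mem hmem] using card_jumpEdges_inter_le x 0 m

/-- The sum, over all edges, of the square of the number of crossings by the first `n` jumps. -/
noncomputable def sumSqCrossings (S : ℕ → ℤ) (n : ℕ) : ℝ :=
  ∑ j ∈ (Finset.range n).biUnion (jumpEdges S),
    (coverCount (Finset.range n) (jumpEdges S) j : ℝ) ^ 2

theorem sumSqCrossings_nonneg (S : ℕ → ℤ) (n : ℕ) : 0 ≤ sumSqCrossings S n :=
  Finset.sum_nonneg fun _ _ => sq_nonneg _

theorem sumSqCrossings_eq_sum_card (S : ℕ → ℤ) (n : ℕ) :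
    sumSqCrossings S n = ∑ k ∈ Finset.range n, ∑ l ∈ Finset.range n,
      ((jumpEdges S k ∩ jumpEdges S l).card : ℝ) :=
  sum_sq_coverCount _ _

theorem integrable_sumSqCrossings (hint : Integrable (fun k : ℤ => (k : ℝ)) p.toMeasure) (n : ℕ) :
    Integrable (fun x => sumSqCrossings (walkOfIncrements x) n) (stepLaw p) := by
  simp_rw [sumSqCrossings_eq_sum_card]
  exact integrable_finsetSum _ fun k _ =>
    integrable_finsetSum _ fun l _ => integrable_card_jumpEdges_inter hint k l

theorem integral_sumSqCrossings_le (hint : Integrable (fun k : ℤ => (k : ℝ)) p.toMeasure)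
    (n : ℕ) :
    ∫ x, sumSqCrossings (walkOfIncrements x) n ∂stepLaw p ≤
      2 * n * ∑ m ∈ Finset.range n, meanOverlap p m := by
  simp_rw [sumSqCrossings_eq_sum_card]
  rw [integral_finsetSum _ fun k _ =>
    integrable_finsetSum _ fun l _ => integrable_card_jumpEdges_inter hint k l]
  simp_rw [integral_finsetSum _ fun l _ => integrable_card_jumpEdges_inter hint _ l,
    integral_card_jumpEdges_inter]
  exact sum_sum_dist_le (meanOverlap_nonneg p) n

theorem tendsto_integral_sumSqCrossings_div_sq
    (hL2 : MemLp (fun k : ℤ => (k : ℝ)) 2 p.toMeasure) (h0 : ∫ k : ℤ, (k : ℝ) ∂p.toMeasure = 0)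
    (hvar : 0 < Var[fun k : ℤ => (k : ℝ); p.toMeasure]) :
    Tendsto (fun n : ℕ =>
      (∫ x, sumSqCrossings (walkOfIncrements x) n ∂stepLaw p) / (n : ℝ) ^ 2) atTop (𝓝 0) := by
  have hcesaro := (tendsto_meanOverlap hL2 h0 hvar).cesaro.const_mul 2
  rw [mul_zero] at hcesaro
  refine squeeze_zero (fun n => div_nonneg (integral_nonneg fun x =>
    sumSqCrossings_nonneg _ n) (sq_nonneg _)) (fun n => ?_) hcesaro
  refine (div_le_div_of_nonneg_right
    (integral_sumSqCrossings_le (hL2.integrable one_le_two) n) (sq_nonneg _)).trans_eq ?_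
  rcases eq_or_ne n 0 with rfl | hn
  · simp
  · field_simp

end Overlap

section LawsOfLargeNumbers

variable {Ω : Type*} {mΩ : MeasurableSpace Ω} {P : Measure Ω}

theorem ae_tendsto_sum_comp_div {α : Type*} {mα : MeasurableSpace α} {κ : Measure α} {f : α → ℝ}
    {X : ℕ → Ω → α} (hlaw : ∀ i, HasLaw (X i) κ P) (hind : Pairwise fun i j => X i ⟂ᵢ[P] X j)
    (hf : Integrable f κ) :
    ∀ᵐ ω ∂P, Tendsto (fun n : ℕ => (∑ i ∈ Finset.range n, f (X i ω)) / n) atTop (𝓝 κ[f]) := by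
  have hfX (i : ℕ) : AEMeasurable f (P.map (X i)) := by
    simpa only [(hlaw i).map_eq] using hf.aemeasurable
  rw [← (hlaw 0).integral_comp hf.1]
  exact strong_law_ae_real (fun i ω => f (X i ω)) (integrable_comp_of_hasLaw (hlaw 0) hf)
    (fun i j hij => (hind hij).comp₀ (hlaw i).aemeasurable (hlaw j).aemeasurable (hfX i) (hfX j))
    fun i => ((hlaw i).identDistrib (hlaw 0)).comp_of_aemeasurable (hfX i)

theorem ae_forall_exists_lt_of_tendstoInMeasure_div {T : ℕ → Ω → ℝ} {c : ℝ} (hc : 0 < c)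
    (hT : TendstoInMeasure P (fun k ω => T k ω / k) atTop fun _ => c) :
    ∀ᵐ ω ∂P, ∀ t, ∃ k, t < T k ω := by
  obtain ⟨k, hk, hlim⟩ := hT.exists_seq_tendsto_ae
  filter_upwards [hlim] with ω hω t
  have hinfty : Tendsto (fun i => T (k i) ω / k i * k i) atTop atTop :=
    hω.pos_mul_atTop hc (tendsto_natCast_atTop_atTop.comp hk.tendsto_atTop)
  obtain ⟨i, hi, hti⟩ := ((eventually_ge_atTop 1).and (hinfty.eventually_gt_atTop t)).exists
  have hki : k i ≠ 0 := Nat.one_le_iff_ne_zero.1 (hi.trans hk.le_apply)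
  rw [div_mul_cancel₀ _ (Nat.cast_ne_zero.2 hki)] at hti
  exact ⟨k i, hti⟩

theorem integral_sqrt_le [IsProbabilityMeasure P] {f : Ω → ℝ} (hf : Integrable f P)
    (hf0 : ∀ ω, 0 ≤ f ω) : Integrable (fun ω => √(f ω)) P ∧ ∫ ω, √(f ω) ∂P ≤ √(∫ ω, f ω ∂P) := by
  have hsqrt : MemLp (fun ω => √(f ω)) 2 P := by
    rw [memLp_two_iff_integrable_sq (Real.continuous_sqrt.comp_aestronglyMeasurable hf.1)]
    simpa only [Real.sq_sqrt (hf0 _)] using hf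
  refine ⟨hsqrt.integrable one_le_two, ?_⟩
  simpa only [Real.sq_sqrt (hf0 _), abs_of_nonneg (Real.sqrt_nonneg _)] using
    integral_abs_le_sqrt hsqrt

theorem integrable_prod_of_integral_abs_le {α β : Type*} {mα : MeasurableSpace α}
    {mβ : MeasurableSpace β} {P : Measure α} {Q : Measure β} [SFinite P] [SFinite Q]
    {F : α × β → ℝ} {b : α → ℝ} (hF : Measurable F) (hFi : ∀ a, Integrable (fun y => F (a, y)) Q)
    (hb : Integrable b P) (hFb : ∀ a, ∫ y, |F (a, y)| ∂Q ≤ b a) :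
    Integrable F (P.prod Q) ∧ ∫ z, |F z| ∂P.prod Q ≤ ∫ a, b a ∂P := by
  have hint : Integrable F (P.prod Q) := by
    refine (integrable_prod_iff hF.aestronglyMeasurable).2 ⟨ae_of_all _ hFi, ?_⟩
    refine hb.mono' hF.aestronglyMeasurable.norm.integral_prod_right' (ae_of_all _ fun a => ?_)
    rw [Real.norm_of_nonneg (integral_nonneg fun _ => norm_nonneg _)]
    exact hFb a
  refine ⟨hint, ?_⟩
  rw [integral_prod _ hint.abs]
  exact integral_mono hint.abs.integral_prod_left hb hFb

end LawsOfLargeNumbers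

section CollisionTime

variable {ν : Measure (Set.Ioi (0 : ℝ))} [IsProbabilityMeasure ν] {p : PMF ℤ}

/-- The law of the i.i.d. gaps `ζ_j`. -/
noncomputable abbrev gapLaw (ν : Measure (Set.Ioi (0 : ℝ))) [IsProbabilityMeasure ν] :
    Measure (ℤ → Set.Ioi (0 : ℝ)) :=
  Measure.infinitePi fun _ : ℤ => ν

/-- The joint law of the increments of the walk and of the gaps, which are independent. -/
noncomputable abbrev jointLaw (ν : Measure (Set.Ioi (0 : ℝ))) [IsProbabilityMeasure ν]
    (p : PMF ℤ) : Measure ((ℕ → ℤ) × (ℤ → Set.Ioi (0 : ℝ))) :=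
  (stepLaw p).prod (gapLaw ν)

theorem hasLaw_fst_jointLaw : HasLaw Prod.fst (stepLaw p) (jointLaw ν p) :=
  measurePreserving_fst.hasLaw

theorem hasLaw_step_jointLaw (i : ℕ) :
    HasLaw (fun z : (ℕ → ℤ) × (ℤ → Set.Ioi (0 : ℝ)) => z.1 i) p.toMeasure (jointLaw ν p) :=
  (hasLaw_eval_infinitePi i).comp hasLaw_fst_jointLaw

theorem iIndepFun_step_jointLaw :
    iIndepFun (fun i (z : (ℕ → ℤ) × (ℤ → Set.Ioi (0 : ℝ))) => z.1 i) (jointLaw ν p) :=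
  (iIndepFun_iff_hasLaw_Pi_infinitePi hasLaw_step_jointLaw measurable_fst.aemeasurable).2
    hasLaw_fst_jointLaw

theorem measurable_walk_env : Measurable fun z : (ℕ → ℤ) × (ℤ → Set.Ioi (0 : ℝ)) =>
    (walkOfIncrements z.1, envOfGaps z.2) :=
  (measurable_walkOfIncrements.comp measurable_fst).prodMk
    (measurable_envOfGaps.comp measurable_snd)

theorem meanGap_pos (hν : Integrable (fun z : Set.Ioi (0 : ℝ) => (z : ℝ)) ν) : 0 < meanGap ν := by
  refine (integral_nonneg fun z => z.2.le).lt_of_ne' fun hzero => ?_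
  obtain ⟨z, hz⟩ := ((integral_eq_zero_iff_of_nonneg
    (fun z : Set.Ioi (0 : ℝ) => z.2.le) hν).1 hzero).exists
  exact z.2.ne' hz

theorem measurable_sum_abs_step (n : ℕ) :
    Measurable fun z : (ℕ → ℤ) × (ℤ → Set.Ioi (0 : ℝ)) => ∑ k ∈ Finset.range n, |(z.1 k : ℝ)| :=
  Finset.measurable_sum _ fun k _ => (measurable_from_top (f := fun k : ℤ => |(k : ℝ)|)).comp
    ((measurable_pi_apply k).comp measurable_fst)

/-- The `n`-th collision time minus its mean given the walk, when `m` is the mean gap. -/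
noncomputable def centeredCollisionTime (m : ℝ) (n : ℕ)
    (z : (ℕ → ℤ) × (ℤ → Set.Ioi (0 : ℝ))) : ℝ :=
  collisionTime (walkOfIncrements z.1) (envOfGaps z.2) n - m * ∑ k ∈ Finset.range n, |(z.1 k : ℝ)|

theorem centeredCollisionTime_eq_sum_coverCount (m : ℝ) (n : ℕ) (x : ℕ → ℤ)
    (ζ : ℤ → Set.Ioi (0 : ℝ)) :
    centeredCollisionTime m n (x, ζ) =
      ∑ j ∈ (Finset.range n).biUnion (jumpEdges (walkOfIncrements x)),
        coverCount (Finset.range n) (jumpEdges (walkOfIncrements x)) j * ((ζ j : ℝ) - m) := by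
  simp_rw [centeredCollisionTime, ← card_jumpEdges_walkOfIncrements]
  exact collisionTime_sub_eq_sum_coverCount _ ζ n m

theorem measurable_centeredCollisionTime (m : ℝ) (n : ℕ) :
    Measurable (centeredCollisionTime m n) :=
  ((measurable_collisionTime n).comp measurable_walk_env).sub
    ((measurable_sum_abs_step n).const_mul m)

theorem integrable_centeredCollisionTime_gaps
    (hν : Integrable (fun z : Set.Ioi (0 : ℝ) => (z : ℝ)) ν) (m : ℝ) (n : ℕ) (x : ℕ → ℤ) :
    Integrable (fun ζ => centeredCollisionTime m n (x, ζ)) (gapLaw ν) := by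
  simp_rw [centeredCollisionTime_eq_sum_coverCount]
  exact integrable_finsetSum _ fun j _ => ((integrable_comp_of_hasLaw
    (hasLaw_eval_infinitePi j) hν).sub (integrable_const _)).const_mul _

theorem exists_integral_abs_centeredCollisionTime_gaps_le
    (hν : Integrable (fun z : Set.Ioi (0 : ℝ) => (z : ℝ)) ν) {ε : ℝ} (hε : 0 < ε) :
    ∃ C : ℝ, 0 ≤ C ∧ ∀ (x : ℕ → ℤ) (n : ℕ),
      ∫ ζ, |centeredCollisionTime (meanGap ν) n (x, ζ)| ∂gapLaw ν ≤
        ε * ∑ k ∈ Finset.range n, |(x k : ℝ)| + C * √(sumSqCrossings (walkOfIncrements x) n) := by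
  obtain ⟨C, hC⟩ := exists_integral_abs_weighted_sum_sub_le (P := gapLaw ν)
    hasLaw_eval_infinitePi (fun _ _ hij => iIndepFun_eval_infinitePi.indepFun hij) hν hε
  refine ⟨max C 0, le_max_right _ _, fun x n => ?_⟩
  simp_rw [centeredCollisionTime_eq_sum_coverCount, ← card_jumpEdges_walkOfIncrements,
    ← sum_coverCount]
  refine (hC _ _ fun j => Nat.cast_nonneg _).trans ?_
  gcongr
  · exact le_max_left _ _
  · exact le_rfl

theorem exists_integral_abs_centeredCollisionTime_le
    (hν : Integrable (fun z : Set.Ioi (0 : ℝ) => (z : ℝ)) ν)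
    (hL2 : MemLp (fun k : ℤ => (k : ℝ)) 2 p.toMeasure) {ε : ℝ} (hε : 0 < ε) :
    ∃ C : ℝ, ∀ n : ℕ, Integrable (centeredCollisionTime (meanGap ν) n) (jointLaw ν p) ∧
      ∫ z, |centeredCollisionTime (meanGap ν) n z| ∂jointLaw ν p ≤
        ε * (n * meanAbsJump p) +
          C * √(∫ x, sumSqCrossings (walkOfIncrements x) n ∂stepLaw p) := by
  obtain ⟨C, hC, hbound⟩ := exists_integral_abs_centeredCollisionTime_gaps_le hν hε
  have hint : Integrable (fun k : ℤ => (k : ℝ)) p.toMeasure := hL2.integrable one_le_two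
  refine ⟨C, fun n => ?_⟩
  have hstep (k : ℕ) : Integrable (fun x : ℕ → ℤ => |(x k : ℝ)|) (stepLaw p) :=
    integrable_comp_of_hasLaw (f := fun k : ℤ => |(k : ℝ)|) (hasLaw_eval_infinitePi k) hint.abs
  have hmean (k : ℕ) : ∫ x : ℕ → ℤ, |(x k : ℝ)| ∂stepLaw p = meanAbsJump p :=
    ((hasLaw_eval_infinitePi k).integral_comp hint.abs.1).trans (integral_abs_step hL2)
  have hsum : Integrable (fun x : ℕ → ℤ => ε * ∑ k ∈ Finset.range n, |(x k : ℝ)|) (stepLaw p) :=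
    (integrable_finsetSum _ fun k _ => hstep k).const_mul ε
  obtain ⟨hsqrt, hsqrt_le⟩ :=
    integral_sqrt_le (integrable_sumSqCrossings hint n) fun x => sumSqCrossings_nonneg _ n
  obtain ⟨hF, hF_le⟩ := integrable_prod_of_integral_abs_le
    (measurable_centeredCollisionTime (meanGap ν) n)
    (integrable_centeredCollisionTime_gaps hν (meanGap ν) n)
    (hsum.add (hsqrt.const_mul C)) fun x => hbound x n
  refine ⟨hF, hF_le.trans ?_⟩
  simp only [Pi.add_apply]
  rw [integral_add hsum (hsqrt.const_mul C), integral_const_mul, integral_const_mul,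
    integral_finsetSum _ fun k _ => hstep k]
  simp only [hmean, Finset.sum_const, Finset.card_range, nsmul_eq_mul]
  gcongr

theorem tendsto_integral_abs_centeredCollisionTime_div
    (hν : Integrable (fun z : Set.Ioi (0 : ℝ) => (z : ℝ)) ν)
    (hL2 : MemLp (fun k : ℤ => (k : ℝ)) 2 p.toMeasure) (h0 : ∫ k : ℤ, (k : ℝ) ∂p.toMeasure = 0)
    (hvar : 0 < Var[fun k : ℤ => (k : ℝ); p.toMeasure]) :
    Tendsto (fun n : ℕ =>
      (∫ z, |centeredCollisionTime (meanGap ν) n z| ∂jointLaw ν p) / n) atTop (𝓝 0) := by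
  have hJ : 0 < meanAbsJump p := meanAbsJump_pos hL2 hvar
  refine tendsto_zero_of_forall_eventually_le_add
    (fun n => div_nonneg (integral_nonneg fun _ => abs_nonneg _) n.cast_nonneg) fun η hη => ?_
  obtain ⟨C, hC⟩ := exists_integral_abs_centeredCollisionTime_le hν hL2 (div_pos hη hJ)
  refine ⟨fun n => C * √((∫ x, sumSqCrossings (walkOfIncrements x) n ∂stepLaw p) / (n : ℝ) ^ 2),
    ?_, ?_⟩
  · simpa using ((tendsto_integral_sumSqCrossings_div_sq hL2 h0 hvar).sqrt).const_mul C
  · filter_upwards [eventually_gt_atTop 0] with n hn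
    have hn' : (0 : ℝ) < n := Nat.cast_pos.2 hn
    rw [Real.sqrt_div' _ (sq_nonneg _), Real.sqrt_sq hn'.le, div_le_iff₀ hn']
    refine (hC n).2.trans_eq ?_
    field_simp

theorem tendstoInMeasure_collisionTime_div
    (hν : Integrable (fun z : Set.Ioi (0 : ℝ) => (z : ℝ)) ν)
    (hL2 : MemLp (fun k : ℤ => (k : ℝ)) 2 p.toMeasure) (h0 : ∫ k : ℤ, (k : ℝ) ∂p.toMeasure = 0)
    (hvar : 0 < Var[fun k : ℤ => (k : ℝ); p.toMeasure]) :
    TendstoInMeasure (jointLaw ν p)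
      (fun n z => collisionTime (walkOfIncrements z.1) (envOfGaps z.2) n / n) atTop
      fun _ => meanGap ν * meanAbsJump p := by
  have hF (n : ℕ) : Integrable (centeredCollisionTime (meanGap ν) n) (jointLaw ν p) :=
    ((exists_integral_abs_centeredCollisionTime_le hν hL2 one_pos).choose_spec n).1
  have hcentered : TendstoInMeasure (jointLaw ν p)
      (fun (n : ℕ) z => centeredCollisionTime (meanGap ν) n z / n) atTop fun _ => 0 := by
    refine tendstoInMeasure_zero_of_tendsto_integral_abs (fun n => (hF n).div_const _) ?_
    simpa only [abs_div, Nat.abs_cast, integral_div] using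
      tendsto_integral_abs_centeredCollisionTime_div hν hL2 h0 hvar
  have hlln := ae_tendsto_sum_comp_div (P := jointLaw ν p) hasLaw_step_jointLaw
    (fun _ _ hij => iIndepFun_step_jointLaw.indepFun hij) (hL2.integrable one_le_two).abs
  rw [integral_abs_step hL2] at hlln
  have hpath := tendstoInMeasure_of_ae_tendsto
    (fun n => (((measurable_sum_abs_step n).div_const (n : ℝ)).const_mul
      (meanGap ν)).aestronglyMeasurable) (hlln.mono fun _ hz => hz.const_mul (meanGap ν))
  have hsum := tendstoInMeasure_add hcentered hpath
  simpa [centeredCollisionTime, sub_div, mul_div_assoc] using hsum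

end CollisionTime

section Environment

variable {ν : Measure (Set.Ioi (0 : ℝ))} [IsProbabilityMeasure ν]

theorem exists_forall_abs_le_of_tendsto_div {a : ℕ → ℝ} (h : Tendsto (fun n => a n / n) atTop (𝓝 0))
    {ε : ℝ} (hε : 0 < ε) : ∃ C : ℝ, ∀ n, |a n| ≤ ε * n + C := by
  obtain ⟨N, hN⟩ := eventually_atTop.1 (h.abs.eventually_lt_const (by simpa using hε))
  refine ⟨∑ n ∈ Finset.range (N + 1), |a n|, fun n => ?_⟩
  have hsum : 0 ≤ ∑ n ∈ Finset.range (N + 1), |a n| := Finset.sum_nonneg fun _ _ => abs_nonneg _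
  rcases le_or_gt n N with hn | hn
  · have hterm := Finset.single_le_sum (f := fun n => |a n|) (fun _ _ => abs_nonneg _)
      (Finset.mem_range_succ_iff.2 hn)
    have : 0 ≤ ε * n := by positivity
    linarith
  · have hn0 : (0 : ℝ) < n := Nat.cast_pos.2 (N.zero_le.trans_lt hn)
    have hdiv := hN n hn.le
    rw [abs_div, abs_of_pos hn0, div_lt_iff₀ hn0] at hdiv
    linarith

theorem target_natCast (ζ : ℤ → Set.Ioi (0 : ℝ)) (n : ℕ) :
    target ζ n = ∑ i ∈ Finset.range n, (ζ (i + 1) : ℝ) := by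
  induction n with
  | zero => simp [target_zero]
  | succ n ih =>
    rw [Finset.sum_range_succ, ← ih, target_eq_add]
    push_cast
    rw [add_sub_cancel_right]

theorem target_neg_natCast (ζ : ℤ → Set.Ioi (0 : ℝ)) (n : ℕ) :
    target ζ (-n) = -∑ i ∈ Finset.range n, (ζ (-i) : ℝ) := by
  induction n with
  | zero => simp [target_zero]
  | succ n ih =>
    have hstep := target_eq_add ζ (-n)
    rw [ih] at hstep
    rw [Finset.sum_range_succ, Nat.cast_succ, neg_add', neg_add, hstep]
    ring

theorem ae_tendsto_sum_gaps_div (hν : Integrable (fun z : Set.Ioi (0 : ℝ) => (z : ℝ)) ν)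
    {i : ℕ → ℤ} (hi : Function.Injective i) :
    ∀ᵐ ζ ∂gapLaw ν, Tendsto
      (fun n : ℕ => (∑ k ∈ Finset.range n, (ζ (i k) : ℝ)) / n) atTop (𝓝 (meanGap ν)) :=
  ae_tendsto_sum_comp_div (fun k => hasLaw_eval_infinitePi (i k))
    (fun _ _ hkl => iIndepFun_eval_infinitePi.indepFun (hi.ne hkl)) hν

theorem ae_forall_exists_abs_target_sub_le
    (hν : Integrable (fun z : Set.Ioi (0 : ℝ) => (z : ℝ)) ν) {ε : ℝ} (hε : 0 < ε) :
    ∀ᵐ ζ ∂gapLaw ν, ∃ C : ℝ, ∀ j : ℤ, |target ζ j - meanGap ν * j| ≤ ε * |(j : ℝ)| + C := by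
  have hcenter {s : ℕ → ℝ} (hs : Tendsto (fun n => s n / n) atTop (𝓝 (meanGap ν))) :
      ∃ C : ℝ, ∀ n : ℕ, |s n - meanGap ν * n| ≤ ε * n + C := by
    refine exists_forall_abs_le_of_tendsto_div (Tendsto.congr' ?_ (sub_self (meanGap ν) ▸
      hs.sub_const (meanGap ν))) hε
    filter_upwards [eventually_ne_atTop 0] with n hn
    field_simp
  filter_upwards [ae_tendsto_sum_gaps_div hν (i := fun k => k + 1) fun k l h => by simpa using h,
    ae_tendsto_sum_gaps_div hν (i := fun k => -k) fun k l h => by simpa using h] with ζ hright hleft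
  obtain ⟨C₁, hC₁⟩ := hcenter hright
  obtain ⟨C₂, hC₂⟩ := hcenter hleft
  refine ⟨max C₁ C₂, fun j => ?_⟩
  obtain ⟨n, rfl | rfl⟩ := j.eq_nat_or_neg
  · rw [target_natCast]
    simpa using (hC₁ n).trans (add_le_add_right (le_max_left C₁ C₂) _)
  · rw [target_neg_natCast, ← abs_neg]
    simpa [neg_add_eq_sub, abs_sub_comm] using
      (hC₂ n).trans (add_le_add_right (le_max_right C₁ C₂) _)

/-- The least `C` such that `|target ζ j - m * j| ≤ ε * |j| + C` for all `j`, if there is one. -/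
noncomputable def targetExcess (m ε : ℝ) (ζ : ℤ → Set.Ioi (0 : ℝ)) : ℝ :=
  ⨆ j : ℤ, (|target ζ j - m * j| - ε * |(j : ℝ)|)

theorem measurable_targetExcess (m ε : ℝ) : Measurable (targetExcess m ε) := by
  have htarget (j : ℤ) : Measurable fun ζ : ℤ → Set.Ioi (0 : ℝ) => target ζ j :=
    (measurable_pi_apply j).comp (measurable_subtype_coe.comp measurable_envOfGaps)
  exact .iSup fun j => ((htarget j).sub_const _).abs.sub_const _

theorem ae_abs_target_sub_le (hν : Integrable (fun z : Set.Ioi (0 : ℝ) => (z : ℝ)) ν)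
    {ε : ℝ} (hε : 0 < ε) :
    ∀ᵐ ζ ∂gapLaw ν, ∀ j : ℤ,
      |target ζ j - meanGap ν * j| ≤ ε * |(j : ℝ)| + targetExcess (meanGap ν) ε ζ := by
  filter_upwards [ae_forall_exists_abs_target_sub_le hν hε] with ζ ⟨C, hC⟩ j
  have hbdd : BddAbove (Set.range fun j : ℤ =>
      |target ζ j - meanGap ν * j| - ε * |(j : ℝ)|) := by
    refine ⟨C, ?_⟩
    rintro _ ⟨j, rfl⟩
    exact sub_le_iff_le_add'.2 (hC j)
  exact sub_le_iff_le_add'.1 (le_ciSup hbdd j)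

end Environment

section Position

variable {S : ℕ → ℤ} {ζ : ℤ → Set.Ioi (0 : ℝ)} {t : ℝ}

theorem abs_position_sub_le {ω : Env} {n : ℕ} (h₁ : collisionTime S ω n ≤ t)
    (h₂ : t < collisionTime S ω (n + 1)) (c : ℝ) :
    |position S ω t - c| ≤ |ω (S n) - c| + |ω (S (n + 1)) - c| := by
  rw [position_eq h₁ h₂, target_succ_eq]
  rcases Int.sign_trichotomy (S (n + 1) - S n) with hs | hs | hs <;>
    simp only [hs, Int.cast_one, Int.cast_zero, Int.cast_neg] <;>
    grind

theorem abs_position_sub_mul_le {m ε C : ℝ} (hm : 0 ≤ m) (hε : 0 ≤ ε)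
    (hζ : ∀ j : ℤ, |target ζ j - m * j| ≤ ε * |(j : ℝ)| + C) {n : ℕ}
    (h₁ : collisionTime S (envOfGaps ζ) n ≤ t) (h₂ : t < collisionTime S (envOfGaps ζ) (n + 1))
    (s : ℝ) :
    |position S (envOfGaps ζ) t - m * s| ≤
      2 * ε * |s| + ((ε + m) * (|S n - s| + |S (n + 1) - s|) + 2 * C) := by
  have hsite (k : ℤ) : |target ζ k - m * s| ≤ ε * |s| + (ε + m) * |k - s| + C := by
    have hk : |(k : ℝ)| ≤ |s| + |k - s| := by
      simpa using abs_add_le s (k - s)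
    calc |target ζ k - m * s| ≤ |target ζ k - m * k| + |m * k - m * s| := abs_sub_le _ _ _
      _ ≤ (ε * (|s| + |k - s|) + C) + m * |k - s| := by
        rw [← mul_sub, abs_mul, abs_of_nonneg hm]
        exact add_le_add_left ((hζ k).trans (by gcongr)) _
      _ = ε * |s| + (ε + m) * |k - s| + C := by ring
  calc |position S (envOfGaps ζ) t - m * s|
      ≤ |target ζ (S n) - m * s| + |target ζ (S (n + 1)) - m * s| :=
        abs_position_sub_le h₁ h₂ (m * s)
    _ ≤ 2 * ε * |s| + ((ε + m) * (|S n - s| + |S (n + 1) - s|) + 2 * C) := by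
      linarith [hsite (S n), hsite (S (n + 1))]

end Position

section ScalingLimit

variable {ν : Measure (Set.Ioi (0 : ℝ))} [IsProbabilityMeasure ν] {p : PMF ℤ}

/-- The asymptotic number of collisions per unit time, `1 / (μ m̄)`. -/
noncomputable def collisionRate (ν : Measure (Set.Ioi (0 : ℝ))) (p : PMF ℤ) : ℝ :=
  (meanGap ν * meanAbsJump p)⁻¹

theorem collisionRate_pos (hν : Integrable (fun z : Set.Ioi (0 : ℝ) => (z : ℝ)) ν)
    (hL2 : MemLp (fun k : ℤ => (k : ℝ)) 2 p.toMeasure)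
    (hvar : 0 < Var[fun k : ℤ => (k : ℝ); p.toMeasure]) : 0 < collisionRate ν p :=
  inv_pos.2 (mul_pos (meanGap_pos hν) (meanAbsJump_pos hL2 hvar))

theorem ae_forall_exists_lt_collisionTime
    (hν : Integrable (fun z : Set.Ioi (0 : ℝ) => (z : ℝ)) ν)
    (hL2 : MemLp (fun k : ℤ => (k : ℝ)) 2 p.toMeasure) (h0 : ∫ k : ℤ, (k : ℝ) ∂p.toMeasure = 0)
    (hvar : 0 < Var[fun k : ℤ => (k : ℝ); p.toMeasure]) :
    ∀ᵐ z ∂jointLaw ν p, ∀ t,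
      ∃ n, t < collisionTime (walkOfIncrements z.1) (envOfGaps z.2) n :=
  ae_forall_exists_lt_of_tendstoInMeasure_div (mul_pos (meanGap_pos hν) (meanAbsJump_pos hL2 hvar))
    (tendstoInMeasure_collisionTime_div hν hL2 h0 hvar)

theorem collisionTime_collisionIndex_le_and_lt {S : ℕ → ℤ} {ω : Env} {t : ℝ} (ht : 0 ≤ t)
    (h : ∃ n, t < collisionTime S ω n) :
    collisionTime S ω (collisionIndex S ω t) ≤ t ∧
      t < collisionTime S ω (collisionIndex S ω t + 1) := by
  obtain ⟨n, h₁, h₂⟩ := exists_index ht h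
  rw [collisionIndex_eq h₁ h₂]
  exact ⟨h₁, h₂⟩

theorem tendstoInMeasure_collisionIndex_div
    (hν : Integrable (fun z : Set.Ioi (0 : ℝ) => (z : ℝ)) ν)
    (hL2 : MemLp (fun k : ℤ => (k : ℝ)) 2 p.toMeasure) (h0 : ∫ k : ℤ, (k : ℝ) ∂p.toMeasure = 0)
    (hvar : 0 < Var[fun k : ℤ => (k : ℝ); p.toMeasure]) :
    TendstoInMeasure (jointLaw ν p)
      (fun (t : ℝ) z => (collisionIndex (walkOfIncrements z.1) (envOfGaps z.2) t : ℝ) / t) atTop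
      fun _ => collisionRate ν p :=
  tendstoInMeasure_index_div (fun _ => collisionTime_mono _ _)
    (mul_pos (meanGap_pos hν) (meanAbsJump_pos hL2 hvar))
    (tendstoInMeasure_collisionTime_div hν hL2 h0 hvar) fun t ht =>
      (ae_forall_exists_lt_collisionTime hν hL2 h0 hvar).mono fun _ hz =>
        collisionTime_collisionIndex_le_and_lt ht (hz t)

theorem tendstoInMeasure_collisionIndex_succ_div
    (hν : Integrable (fun z : Set.Ioi (0 : ℝ) => (z : ℝ)) ν)
    (hL2 : MemLp (fun k : ℤ => (k : ℝ)) 2 p.toMeasure) (h0 : ∫ k : ℤ, (k : ℝ) ∂p.toMeasure = 0)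
    (hvar : 0 < Var[fun k : ℤ => (k : ℝ); p.toMeasure]) :
    TendstoInMeasure (jointLaw ν p) (fun (t : ℝ) z =>
      ((collisionIndex (walkOfIncrements z.1) (envOfGaps z.2) t + 1 : ℕ) : ℝ) / t) atTop
      fun _ => collisionRate ν p := by
  simpa [add_div] using tendstoInMeasure_add (tendstoInMeasure_collisionIndex_div hν hL2 h0 hvar)
    (tendstoInMeasure_of_ae_tendsto (fun _ => aestronglyMeasurable_const)
      (ae_of_all _ fun _ => tendsto_inv_atTop_zero))

theorem tendstoInMeasure_walk_sub_walk_floor_div_sqrt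
    (hL2 : MemLp (fun k : ℤ => (k : ℝ)) 2 p.toMeasure) (h0 : ∫ k : ℤ, (k : ℝ) ∂p.toMeasure = 0)
    {θ : ℝ} (hθ : 0 ≤ θ) {n : ℝ → (ℕ → ℤ) × (ℤ → Set.Ioi (0 : ℝ)) → ℕ}
    (hn : TendstoInMeasure (jointLaw ν p) (fun t z => (n t z : ℝ) / t) atTop fun _ => θ) :
    TendstoInMeasure (jointLaw ν p) (fun t z =>
      ((walkOfIncrements z.1 (n t z) : ℝ) - walkOfIncrements z.1 ⌊θ * t⌋₊) / √t)
      atTop fun _ => 0 := by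
  have hcast : Measurable fun k : ℤ => (k : ℝ) := measurable_from_top
  have hfloor : TendstoInMeasure (jointLaw ν p) (fun (t : ℝ) _ => (⌊θ * t⌋₊ : ℝ) / t) atTop
      fun _ => θ :=
    tendstoInMeasure_of_ae_tendsto (fun _ => aestronglyMeasurable_const)
      (ae_of_all _ fun _ => tendsto_nat_floor_mul_div_atTop hθ)
  simp only [cast_walkOfIncrements]
  exact tendstoInMeasure_sum_sub_sum_div_sqrt
    (X := fun i (z : (ℕ → ℤ) × (ℤ → Set.Ioi (0 : ℝ))) => (z.1 i : ℝ))
    (fun i => (hcast.comp ((measurable_pi_apply i).comp measurable_fst)).stronglyMeasurable)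
    (fun i => memLp_comp_of_hasLaw (hasLaw_step_jointLaw i) hL2)
    (iIndepFun_step_jointLaw.comp (fun _ k => (k : ℝ)) fun _ => hcast)
    (fun i => ((hasLaw_step_jointLaw i).integral_comp hL2.1).trans h0)
    (fun i => (variance_comp_of_hasLaw (hasLaw_step_jointLaw i) hL2.1.aemeasurable).le) hn hfloor

theorem tendstoInMeasure_abs_walk_collisionIndex_sub_div_sqrt
    (hν : Integrable (fun z : Set.Ioi (0 : ℝ) => (z : ℝ)) ν)
    (hL2 : MemLp (fun k : ℤ => (k : ℝ)) 2 p.toMeasure) (h0 : ∫ k : ℤ, (k : ℝ) ∂p.toMeasure = 0)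
    (hvar : 0 < Var[fun k : ℤ => (k : ℝ); p.toMeasure]) :
    TendstoInMeasure (jointLaw ν p) (fun (t : ℝ) z =>
      (|(walkOfIncrements z.1 (collisionIndex (walkOfIncrements z.1) (envOfGaps z.2) t) : ℝ) -
          walkOfIncrements z.1 ⌊collisionRate ν p * t⌋₊| +
        |(walkOfIncrements z.1 (collisionIndex (walkOfIncrements z.1) (envOfGaps z.2) t + 1) : ℝ) -
          walkOfIncrements z.1 ⌊collisionRate ν p * t⌋₊|) / √t) atTop fun _ => 0 := by
  have hrate : 0 ≤ collisionRate ν p := (collisionRate_pos hν hL2 hvar).le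
  have hleft := tendstoInMeasure_walk_sub_walk_floor_div_sqrt hL2 h0 hrate
    (tendstoInMeasure_collisionIndex_div hν hL2 h0 hvar)
  have hright := tendstoInMeasure_walk_sub_walk_floor_div_sqrt hL2 h0 hrate
    (tendstoInMeasure_collisionIndex_succ_div hν hL2 h0 hvar)
  simpa only [Real.norm_eq_abs, abs_div, abs_of_nonneg (Real.sqrt_nonneg _), ← add_div, add_zero]
    using tendstoInMeasure_add (tendstoInMeasure_norm hleft) (tendstoInMeasure_norm hright)

theorem memLp_walk_div (hL2 : MemLp (fun k : ℤ => (k : ℝ)) 2 p.toMeasure) (n : ℕ) (a : ℝ) :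
    MemLp (fun z => (walkOfIncrements z.1 n : ℝ) / a) 2 (jointLaw ν p) := by
  simpa only [div_eq_inv_mul] using
    (memLp_walkOfIncrements hasLaw_step_jointLaw hL2 n).const_mul a⁻¹

theorem integral_sq_walk_floor_div_sqrt_le
    (hL2 : MemLp (fun k : ℤ => (k : ℝ)) 2 p.toMeasure) (h0 : ∫ k : ℤ, (k : ℝ) ∂p.toMeasure = 0)
    {θ t : ℝ} (hθ : 0 ≤ θ) (ht : 0 < t) :
    ∫ z, ((walkOfIncrements z.1 ⌊θ * t⌋₊ : ℝ) / √t) ^ 2 ∂jointLaw ν p ≤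
      θ * Var[fun k : ℤ => (k : ℝ); p.toMeasure] := by
  simp_rw [div_pow, Real.sq_sqrt ht.le]
  rw [integral_div, integral_sq_walkOfIncrements hasLaw_step_jointLaw iIndepFun_step_jointLaw hL2
    h0, div_le_iff₀ ht, mul_right_comm]
  exact mul_le_mul_of_nonneg_right (Nat.floor_le (by positivity)) (variance_nonneg _ _)

theorem tendstoInMeasure_position_sub_div_sqrt
    (hν : Integrable (fun z : Set.Ioi (0 : ℝ) => (z : ℝ)) ν)
    (hL2 : MemLp (fun k : ℤ => (k : ℝ)) 2 p.toMeasure) (h0 : ∫ k : ℤ, (k : ℝ) ∂p.toMeasure = 0)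
    (hvar : 0 < Var[fun k : ℤ => (k : ℝ); p.toMeasure]) :
    TendstoInMeasure (jointLaw ν p) (fun (t : ℝ) z =>
      (position (walkOfIncrements z.1) (envOfGaps z.2) t -
        meanGap ν * walkOfIncrements z.1 ⌊collisionRate ν p * t⌋₊) / √t) atTop fun _ => 0 := by
  have hm : 0 < meanGap ν := meanGap_pos hν
  have hrate : 0 ≤ collisionRate ν p := (collisionRate_pos hν hL2 hvar).le
  refine tendstoInMeasure_zero_of_abs_le_mul_add
    (fun t => memLp_walk_div hL2 ⌊collisionRate ν p * t⌋₊ √t)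
    ((eventually_gt_atTop 0).mono fun t ht => integral_sq_walk_floor_div_sqrt_le hL2 h0 hrate ht)
    fun ε hε => ?_
  have hexcess : TendstoInMeasure (jointLaw ν p)
      (fun (t : ℝ) z => targetExcess (meanGap ν) (ε / 2) z.2 / √t) atTop fun _ => 0 :=
    tendstoInMeasure_of_ae_tendsto (fun t => (((measurable_targetExcess _ _).comp
      measurable_snd).div_const _).aestronglyMeasurable)
      (ae_of_all _ fun z => tendsto_const_nhds.div_atTop Real.tendsto_sqrt_atTop)
  have hshift := tendstoInMeasure_abs_walk_collisionIndex_sub_div_sqrt hν hL2 h0 hvar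
  have hrest := tendstoInMeasure_add (tendstoInMeasure_const_mul (ε / 2 + meanGap ν) hshift)
    (tendstoInMeasure_const_mul 2 hexcess)
  rw [add_zero] at hrest
  refine ⟨_, hrest, ?_⟩
  filter_upwards [eventually_gt_atTop 0] with t ht
  filter_upwards [ae_forall_exists_lt_collisionTime hν hL2 h0 hvar,
    Measure.quasiMeasurePreserving_snd.ae (ae_abs_target_sub_le hν (half_pos hε))]
    with z hunbounded htarget
  obtain ⟨h₁, h₂⟩ := collisionTime_collisionIndex_le_and_lt ht.le (hunbounded t)
  have hbound := abs_position_sub_mul_le hm.le (half_pos hε).le htarget h₁ h₂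
    (walkOfIncrements z.1 ⌊collisionRate ν p * t⌋₊)
  have hsqrt : 0 < √t := Real.sqrt_pos.2 ht
  rw [abs_div, abs_div, abs_of_pos hsqrt, div_le_iff₀ hsqrt]
  refine hbound.trans_eq ?_
  field_simp

end ScalingLimit

section AnnealedLaw

variable {ν : Measure (Set.Ioi (0 : ℝ))} [IsProbabilityMeasure ν] {p : PMF ℤ}

theorem tendstoInDistribution_position_div_sqrt
    (hν : Integrable (fun z : Set.Ioi (0 : ℝ) => (z : ℝ)) ν)
    (hL2 : MemLp (fun k : ℤ => (k : ℝ)) 2 p.toMeasure) (h0 : ∫ k : ℤ, (k : ℝ) ∂p.toMeasure = 0)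
    (hvar : 0 < Var[fun k : ℤ => (k : ℝ); p.toMeasure]) :
    TendstoInDistribution
      (fun (t : ℝ) z => position (walkOfIncrements z.1) (envOfGaps z.2) t / √t) atTop
      (id : ℝ → ℝ) (fun _ => jointLaw ν p)
      (gaussianReal 0
        (meanGap ν / meanAbsJump p * Var[fun k : ℤ => (k : ℝ); p.toMeasure]).toNNReal) := by
  have hm : meanGap ν ≠ 0 := (meanGap_pos hν).ne'
  have hvariance : meanGap ν / meanAbsJump p * Var[fun k : ℤ => (k : ℝ); p.toMeasure] =
      meanGap ν ^ 2 * (collisionRate ν p * Var[fun k : ℤ => (k : ℝ); p.toMeasure]) := by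
    rw [collisionRate]
    field_simp
  rw [hvariance]
  have hwalk := tendstoInDistribution_walkOfIncrements_floor_div_sqrt
    (hasLaw_step_jointLaw (ν := ν)) iIndepFun_step_jointLaw hL2 h0 (collisionRate_pos hν hL2 hvar)
    (hasLaw_gaussianReal_zero_div hm HasLaw.id)
  have hscaled := (hwalk.continuous_comp (continuous_const_mul (meanGap ν))).congr
    (fun _ => ae_eq_rfl) (ae_of_all _ fun _ => mul_div_cancel₀ _ hm)
  refine tendstoInDistribution_of_tendstoInMeasure_sub _ _ hscaled ?_ fun t =>
    (((measurable_position t).comp measurable_walk_env).div_const _).aemeasurable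
  refine (tendstoInMeasure_position_sub_div_sqrt hν hL2 h0 hvar).congr_left fun t => ?_
  exact ae_of_all _ fun z => by simp [sub_div, mul_div_assoc]

theorem identDistrib_path_annealedLaw :
    IdentDistrib (fun z => path (walkOfIncrements z.1) (envOfGaps z.2)) Prod.fst
      (jointLaw ν p) (annealedLaw ν p) where
  aemeasurable_fst := (measurable_path.comp measurable_walk_env).aemeasurable
  aemeasurable_snd := measurable_fst.aemeasurable
  map_eq := by
    have hjoint : (jointLaw ν p).map (fun z => path (walkOfIncrements z.1) (envOfGaps z.2)) =
        ((walkLaw p).prod (envLaw ν)).map fun x => path x.1 x.2 := by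
      rw [walkLaw, envLaw, Measure.map_prod_map _ _ measurable_walkOfIncrements
        measurable_envOfGaps, Measure.map_map measurable_path
        (measurable_walkOfIncrements.prodMap measurable_envOfGaps)]
      rfl
    ext G hG
    rw [hjoint, annealedLaw, Measure.map_map measurable_fst measurable_swap,
      Measure.map_apply measurable_path hG, Measure.prod_apply_symm (measurable_path hG),
      Measure.map_apply (measurable_fst.comp measurable_swap) hG,
      Measure.compProd_apply ((measurable_fst.comp measurable_swap) hG)]
    exact lintegral_congr fun ω => (Measure.map_apply
      (measurable_path.comp (measurable_id.prodMk measurable_const)) hG).symm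

theorem tendstoInDistribution_annealedLaw
    (hν : Integrable (fun z : Set.Ioi (0 : ℝ) => (z : ℝ)) ν)
    (hL2 : MemLp (fun k : ℤ => (k : ℝ)) 2 p.toMeasure) (h0 : ∫ k : ℤ, (k : ℝ) ∂p.toMeasure = 0)
    (hvar : 0 < Var[fun k : ℤ => (k : ℝ); p.toMeasure]) :
    TendstoInDistribution (fun (t : ℝ≥0) (z : PathSpace × Env) => z.1 t / √(t : ℝ)) atTop
      (id : ℝ → ℝ) (fun _ => annealedLaw ν p)
      (gaussianReal 0
        (meanGap ν / meanAbsJump p * Var[fun k : ℤ => (k : ℝ); p.toMeasure]).toNNReal) := by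
  have hposition := tendstoInDistribution_comp_tendsto
    (tendstoInDistribution_position_div_sqrt hν hL2 h0 hvar) (NNReal.tendsto_coe_atTop.2 tendsto_id)
  have hpath := hposition.congr (Y := fun (t : ℝ≥0) z =>
    path (walkOfIncrements z.1) (envOfGaps z.2) t / √(t : ℝ)) (fun t => by
      filter_upwards [ae_forall_exists_lt_collisionTime hν hL2 h0 hvar] with z hz
      simp [path, hz]) ae_eq_rfl
  exact tendstoInDistribution_congr_identDistrib hpath fun t => identDistrib_path_annealedLaw.comp
    ((continuous_eval_const t).measurable.div_const √(t : ℝ))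

end AnnealedLaw

end LevyWalk

theorem mainTheorem3_general
    (ν : MeasureTheory.Measure (Set.Ioi (0 : ℝ))) [IsProbabilityMeasure ν]
    (hν : Integrable (fun z : Set.Ioi (0 : ℝ) => (z : ℝ)) ν)
    (p : PMF ℤ)
    (hmean : ∑' k : ℤ, (k : ℝ) * (p k).toReal = 0)
    (hv : Summable fun k : ℤ => (k : ℝ) ^ 2 * (p k).toReal)
    (hv_pos : 0 < ∑' k : ℤ, (k : ℝ) ^ 2 * (p k).toReal) :
    Tendsto (LevyWalk.normalizedMoment p 2) atTop (𝓝 (LevyWalk.rescaledMoment p 2)) ∧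
    TendstoInDistribution
      (fun (t : ℝ≥0) (z : LevyWalk.PathSpace × LevyWalk.Env) => z.1 t / √(t : ℝ))
      atTop (id : ℝ → ℝ) (fun _ => LevyWalk.annealedLaw ν p)
      (gaussianReal 0
        (LevyWalk.meanGap ν / LevyWalk.meanAbsJump p * LevyWalk.rescaledMoment p 2).toNNReal) := by
  have hL2 := LevyWalk.memLp_two_step hv
  have h0 : ∫ k : ℤ, (k : ℝ) ∂p.toMeasure = 0 :=
    (LevyWalk.integral_toMeasure (hL2.integrable one_le_two)).trans hmean
  have hvar : 0 < Var[fun k : ℤ => (k : ℝ); p.toMeasure] := by rwa [LevyWalk.variance_step hL2 h0]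
  rw [LevyWalk.rescaledMoment_two hL2 h0]
  exact ⟨LevyWalk.tendsto_normalizedMoment_two hL2 h0,
    LevyWalk.tendstoInDistribution_annealedLaw hν hL2 h0 hvar⟩

theorem mainTheorem3
    (ν : MeasureTheory.Measure (Set.Ioi (0 : ℝ))) [IsProbabilityMeasure ν]
    (hν : Integrable (fun z : Set.Ioi (0 : ℝ) => (z : ℝ)) ν)
    (p : PMF ℤ)
    (hsymm : ∀ k : ℤ, p (-k) = p k)
    (hmono : ∀ k : ℤ, 0 ≤ k → p (k + 1) ≤ p k)
    (hv : Summable fun k : ℤ => (k : ℝ) ^ 2 * (p k).toReal)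
    (hv_pos : 0 < ∑' k : ℤ, (k : ℝ) ^ 2 * (p k).toReal) :
    Tendsto (LevyWalk.normalizedMoment p 2) atTop (𝓝 (LevyWalk.rescaledMoment p 2)) ∧
    TendstoInDistribution
      (fun (t : ℝ≥0) (z : LevyWalk.PathSpace × LevyWalk.Env) => z.1 t / √(t : ℝ))
      atTop (id : ℝ → ℝ) (fun _ => LevyWalk.annealedLaw ν p)
      (gaussianReal 0
        (LevyWalk.meanGap ν / LevyWalk.meanAbsJump p * LevyWalk.rescaledMoment p 2).toNNReal) :=
  mainTheorem3_general ν hν p (LevyWalk.tsum_mul_eq_zero_of_symm hsymm) hv hv_pos
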